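/- Let $\mathbb{B}=\{q\in\mathbb{H}:|q|<1\}$ be the quaternionic unit ball, let $\mathbb{S}=\{I\in\mathbb{H}: I^2=-1\}$, $L_I=\mathbb{R}+\mathbb{R}I$, and let $r\mathbb{S}^3=\{q\in\mathbb{H}:|q|=r\}$. The Hardy space $H^2(\mathbb{B})$ consists of the power series $f(q)=\sum_{n\ge 0}q^na_n$, $a_n\in\mathbb{H}$, with $\|f\|^2:=\sum_{n\ge0}|a_n|^2<\infty$; these converge in $\mathbb{B}$. Let $g$ be the Riemannian metric on $\mathbb{B}$ with $$|d|_{g(w)}^2=\frac{|d_1|^2}{(1-|w|^2)^2}+\frac{|d_2|^2}{|1-w^2|^2},\qquad d=d_1+d_2,\quad d_1\in L_{I_w},\ d_2\in L_{I_w}^{\perp},$$ for $w\in L_{I_w}$ and $d\in T_w\mathbb{B}\cong\mathbb{H}$, and let $dVol_{r\mathbb{S}^3}$, $0<r<1$, be the volume form induced by $g$ on $r\mathbb{S}^3$. Let $f\in H^2(\mathbb{B})$. For $0<r<1$ the volume $Vol_{r\mathbb{S}^3}(r\mathbb{S}^3)$ is positive and finite, $|f|^2$ is integrable on $r\mathbb{S}^3$,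 and $$\|f\|^2=\lim_{r\to1^-}\frac{1}{Vol_{r\mathbb{S}^3}(r\mathbb{S}^3)}\int_{r\mathbb{S}^3}|f|^2\,dVol_{r\mathbb{S}^3}.$$ Moreover, the limit $dVol_{\mathbb{S}^3}(u):=\lim_{r\to1^-}(1-r^2)\,dVol_{r\mathbb{S}^3}(ru)$ (of the densities with respect to the Euclidean surface measure of $\mathbb{S}^3$; its value at $u=\pm1$ is $+\infty$) exists for every $u\in\mathbb{S}^3$; it is the measure $\frac14\,dt\,dA_{\mathbb{S}}(I)$ in the coordinates $u=e^{tI}$, $t\in[0,\pi]$, $I\in\mathbb{S}$, where $dA_{\mathbb{S}}$ is the area element of the two-sphere $\mathbb{S}$; its total mass is $Vol_{\mathbb{S}^3}(\mathbb{S}^3)=\pi^2$; and $$\|f\|^2=\lim_{r\to1^-}\frac{1-r^2}{Vol_{\mathbb{S}^3}(\mathbb{S}^3)}\int_{r\mathbb{S}^3}|f|^2\,dVol_{r\mathbb{S}^3}.$$ Finally, the radial limit $f(u)=\lim_{r\to1^-}f(ru)$ exists for $dVol_{\mathbb{S}^3}$-almost every $u\in\mathbb{S}^3$, $|f|^2$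 is integrable on $\mathbb{S}^3$, and $$\int_{\mathbb{S}^3}|f(u)|^2\,dVol_{\mathbb{S}^3}(u)=\pi^2\,\|f\|^2 .$$ -/

import Mathlib

open Filter Topology MeasureTheory Metric Set
open scoped Quaternion ENNReal

noncomputable section

namespace QuatHardy

/-- The quaternions carry their Borel σ-algebra. -/
instance instMeasurableSpaceQuaternion : MeasurableSpace ℍ[ℝ] := borel ℍ[ℝ]

instance instBorelSpaceQuaternion : BorelSpace ℍ[ℝ] := ⟨rfl⟩

/-- The imaginary quaternion `x i + y j + z k`. -/
def imag (x y z : ℝ) : ℍ[ℝ] := ⟨0, x, y, z⟩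

@[simp] theorem imag_re (x y z : ℝ) : (imag x y z).re = 0 := rfl

@[simp] theorem imag_imI (x y z : ℝ) : (imag x y z).imI = x := rfl

@[simp] theorem imag_imJ (x y z : ℝ) : (imag x y z).imJ = y := rfl

@[simp] theorem imag_imK (x y z : ℝ) : (imag x y z).imK = z := rfl

/-! ### The Hardy space: power series `∑ qⁿ aₙ` with square summable coefficients -/

/-- The coefficient sequence `a` defines an element of the quaternionic Hardy space. -/
def MemHardy (a : ℕ → ℍ[ℝ]) : Prop := Summable fun n => ‖a n‖ ^ 2

/-- The Hardy norm `(∑ |aₙ|²)^(1/2)`. -/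
def hardyNorm (a : ℕ → ℍ[ℝ]) : ℝ := Real.sqrt (∑' n, ‖a n‖ ^ 2)

/-- The function `f(q) = ∑ qⁿ aₙ` (coefficients on the right). -/
def eval (a : ℕ → ℍ[ℝ]) (q : ℍ[ℝ]) : ℍ[ℝ] := ∑' n, q ^ n * a n

/-- The radial limit `lim_{r → 1⁻} f(r u)`. -/
def radialLimit (f : ℍ[ℝ] → ℍ[ℝ]) (u : ℍ[ℝ]) : ℍ[ℝ] :=
  limUnder (𝓝[<] (1 : ℝ)) fun r => f (r • u)

/-! ### The Riemannian metric `g` on the unit ball -/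

/-- The slice `L_{I_w} = ℝ + ℝ I_w` through `w`, for `w` not real.  For real `w` this is only `ℝ`;
there the two coefficients of the metric `g` agree, so that the choice of a slice is immaterial. -/
def slice (w : ℍ[ℝ]) : Submodule ℝ ℍ[ℝ] := Submodule.span ℝ {1, w}

/-- The component `d₁` of the tangent vector `d` at `w` in the slice through `w`. -/
def slicePart (w d : ℍ[ℝ]) : ℍ[ℝ] := (slice w).starProjection d

/-- The inner product `g_w(d, e)` of two tangent vectors at `w`: it is the polarization of
`|d|² = |d₁|² / (1 - |w|²)² + |d₂|² / |1 - w²|²`, with `d = d₁ + d₂`, `d₁` in the slice through `w`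
and `d₂` orthogonal to it. -/
def g (w d e : ℍ[ℝ]) : ℝ :=
  inner ℝ (slicePart w d) (slicePart w e) / (1 - ‖w‖ ^ 2) ^ 2 +
    inner ℝ (d - slicePart w d) (e - slicePart w e) / ‖1 - w ^ 2‖ ^ 2

/-! ### The volume induced by `g` on the spheres centred at the origin -/

/-- The frame `w i / |w|, w j / |w|, w k / |w|` of the tangent space at `w ≠ 0` of the Euclidean sphere
of radius `|w|`; it is orthonormal for the Euclidean inner product, see `orthonormal_frame`. -/
def frame (w : ℍ[ℝ]) (m : Fin 3) : ℍ[ℝ] :=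
  ‖w‖⁻¹ • (w * (![imag 1 0 0, imag 0 1 0, imag 0 0 1] : Fin 3 → ℍ[ℝ]) m)

theorem orthonormal_frame (w : ℍ[ℝ]) (hw : w ≠ 0) :
    Orthonormal ℝ (frame w) ∧ ∀ m, inner ℝ w (frame w m) = 0 := by
  have h0 : ‖w‖ ≠ 0 := norm_ne_zero_iff.mpr hw
  have hn : ‖w‖ ^ 2 = w.re ^ 2 + w.imI ^ 2 + w.imJ ^ 2 + w.imK ^ 2 := by
    rw [← Quaternion.normSq_def', Quaternion.normSq_eq_norm_mul_self, sq]
  constructor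
  · rw [orthonormal_iff_ite]
    intro m n
    simp only [frame, inner_smul_left, inner_smul_right, Quaternion.inner_def]
    fin_cases m <;> fin_cases n <;> simp <;> first
      | (field_simp; rw [hn]; ring)
      | (right; ring)
  · intro m
    simp only [frame, inner_smul_right, Quaternion.inner_def]
    fin_cases m <;> simp <;> right <;> ring

/-- The density at `w` of the Riemannian volume, that `g` induces on the sphere of radius `|w|`, with
respect to the Euclidean surface measure: the square root of the Gram determinant of `g_w` on a
Euclidean orthonormal basis of the tangent space of the sphere. -/
def volDensity (w : ℍ[ℝ]) : ℝ≥0∞ :=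
  ENNReal.ofReal (Real.sqrt (Matrix.of fun m n => g w (frame w m) (frame w n)).det)

/-- The Euclidean surface measure of the sphere `r 𝕊³`, as a measure on `ℍ`. -/
def sphereArea (r : ℝ) : Measure ℍ[ℝ] :=
  ENNReal.ofReal (r ^ 3) •
    ((volume : Measure ℍ[ℝ]).toSphere).map fun u : sphere (0 : ℍ[ℝ]) 1 => r • (u : ℍ[ℝ])

/-- The Riemannian volume that `g` induces on the sphere `r 𝕊³`, `0 < r < 1`. -/
def sphereVol (r : ℝ) : Measure ℍ[ℝ] := (sphereArea r).withDensity volDensity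

/-! ### The induced volume on the boundary sphere -/

/-- The density, with respect to the Euclidean surface measure of `𝕊³`, of `1 - r²` times the
pull-back of the volume of `r 𝕊³` under `u ↦ r u`. -/
def scaledDensity (r : ℝ) (u : ℍ[ℝ]) : ℝ≥0∞ :=
  ENNReal.ofReal (1 - r ^ 2) * (ENNReal.ofReal (r ^ 3) * volDensity (r • u))

/-- The density of the boundary volume: the limit of `scaledDensity r u` as `r → 1⁻`. -/
def boundaryDensity (u : ℍ[ℝ]) : ℝ≥0∞ :=
  limUnder (𝓝[<] (1 : ℝ)) fun r => scaledDensity r u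

/-- The volume `lim_{r → 1⁻} (1 - r²) dVol_{r 𝕊³}(r u)` on the boundary sphere `𝕊³`. -/
def boundaryVol : Measure ℍ[ℝ] := (sphereArea 1).withDensity boundaryDensity

/-- The imaginary quaternion with the given coordinates; on the unit sphere of `ℝ³` this
parametrizes the sphere `𝕊` of imaginary units. -/
def imUnit (v : EuclideanSpace ℝ (Fin 3)) : ℍ[ℝ] := imag (v 0) (v 1) (v 2)

/-- The measure `(1/4) dt dA(I)` on `𝕊³`, in the coordinates `e^{tI} = cos t + (sin t) I` with
`t ∈ [0, π]` and `I ∈ 𝕊`, where `dA` is the area measure of the two-dimensional unit sphere `𝕊`. -/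
def polarVol : Measure ℍ[ℝ] :=
  (1 / 4 : ℝ≥0∞) •
    (((volume : Measure ℝ).restrict (Icc 0 Real.pi)).prod
      (volume : Measure (EuclideanSpace ℝ (Fin 3))).toSphere).map
      fun p : ℝ × sphere (0 : EuclideanSpace ℝ (Fin 3)) 1 =>
        ((Real.cos p.1 : ℝ) : ℍ[ℝ]) + Real.sin p.1 • imUnit p.2

end QuatHardy

end

/-! The tangent space of the sphere `r 𝕊³` at a nonreal `w` is spanned by one direction in the
slice, which `g` scales by `1/(1 - |w|²)`, and two orthogonal to it, scaled by `1/|1 - w²|`. The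
volume density is therefore `1/((1 - |w|²)|1 - w²|²)` (`volDensity_eq`). For `w = r e^{tI}` one has
`|1 - w²|² = (1 - r²)² + 4r² sin² t`, and the surface measure is `r³ sin² t dt dA(I)`
(`lintegral_sphereArea`). Hence `(1 - r²)` times the induced volume is `κ_r(t) dt dA(I)`, where
`κ_r` is `angularKernel`, with `0 ≤ κ_r ≤ 1/4` and `κ_r → 1/4` wherever `sin t ≠ 0`. This gives the
boundary measure and its mass `(1/4)·π·4π = π²`.

Since `(e^{tI})ⁿ = cos nt + I sin nt`, the restriction of `f` to a slice is `f(r e^{tI}) = U + I V`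
with `U`, `V` independent of `I`. In an orthonormal basis of `ℍ`, the components of `U + iV` are
four complex power series with real square summable coefficients, evaluated at `r e^{it}`
(`hasSum_eval_polarPoint`). The symmetry `I ↦ -I` removes the cross term of `|U + I V|²`, so
integration over `𝕊` leaves `4π(|U|² + |V|²)` (`lintegral_norm_sq_add_imUnit_mul`). Everything
reduces to integrals of `|F_j(r e^{it})|²` over `[0, π]`, and for real coefficients these are half
of the integrals over the circle.

The limit is squeezed. The bounds `κ_r ≤ 1/4` and Parseval's identity on the circle of radius `r`
give the upper estimate. For the lower one, Fatou's lemma is combined with the almost everywhere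
radial limits of the `F_j` (`HasHardyCoeffs.ae_tendsto`), whose square integrals are again given by
Parseval (`tendsto_lintegral_angularKernel_mul`). The constant series `1` yields the total volumes,
hence the normalized average. The radial limits on slices also give the boundary values of `f` and
their square integral. -/

namespace QuatHardy

/-! ### The Poisson kernel and Fatou's theorem -/

/-- The Poisson kernel of the unit disc. -/
noncomputable def poissonKer (r s : ℝ) : ℝ := (1 - r ^ 2) / (1 - 2 * r * Real.cos s + r ^ 2)

/-- The derivative of the Poisson kernel in the angular variable. -/
noncomputable def poissonKerDeriv (r s : ℝ) : ℝ :=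
  -((1 - r ^ 2) * (2 * r * Real.sin s)) / (1 - 2 * r * Real.cos s + r ^ 2) ^ 2

theorem poissonKer_denom_eq (r s : ℝ) :
    1 - 2 * r * Real.cos s + r ^ 2 = (1 - r) ^ 2 + 2 * r * (1 - Real.cos s) := by ring

theorem poissonKer_denom_pos {r : ℝ} (hr : r ∈ Ioo (0 : ℝ) 1) (s : ℝ) :
    0 < 1 - 2 * r * Real.cos s + r ^ 2 := by
  rw [poissonKer_denom_eq]
  have h1 : 0 < (1 - r) ^ 2 := pow_pos (sub_pos.2 hr.2) 2
  have h2 : 0 ≤ 2 * r * (1 - Real.cos s) :=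
    mul_nonneg (by linarith [hr.1]) (sub_nonneg.2 (Real.cos_le_one s))
  linarith

theorem hasDerivAt_poissonKer {r : ℝ} (hr : r ∈ Ioo (0 : ℝ) 1) (s : ℝ) :
    HasDerivAt (poissonKer r) (poissonKerDeriv r s) s := by
  have hd : HasDerivAt (fun s => 1 - 2 * r * Real.cos s + r ^ 2) (2 * r * Real.sin s) s := by
    have := ((Real.hasDerivAt_cos s).const_mul (2 * r)).const_sub 1 |>.add_const (r ^ 2)
    exact this.congr_deriv (by ring)
  have := (hasDerivAt_const s (1 - r ^ 2)).div hd (poissonKer_denom_pos hr s).ne'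
  exact this.congr_deriv (by rw [poissonKerDeriv]; ring)

theorem continuous_poissonKer {r : ℝ} (hr : r ∈ Ioo (0 : ℝ) 1) : Continuous (poissonKer r) :=
  continuous_iff_continuousAt.2 fun s => (hasDerivAt_poissonKer hr s).continuousAt

theorem continuous_poissonKerDeriv {r : ℝ} (hr : r ∈ Ioo (0 : ℝ) 1) :
    Continuous (poissonKerDeriv r) := by
  unfold poissonKerDeriv
  exact Continuous.div (by fun_prop) (by fun_prop) fun s => (pow_pos (poissonKer_denom_pos hr s) 2).ne'

theorem absolutelyContinuousOnInterval_poissonKer {r : ℝ} (hr : r ∈ Ioo (0 : ℝ) 1) (a b : ℝ) :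
    AbsolutelyContinuousOnInterval (poissonKer r) a b := by
  have h : ContDiff ℝ 1 (poissonKer r) := by
    rw [contDiff_one_iff_deriv]
    refine ⟨fun s => (hasDerivAt_poissonKer hr s).differentiableAt, ?_⟩
    rw [show deriv (poissonKer r) = poissonKerDeriv r from
      funext fun s => (hasDerivAt_poissonKer hr s).deriv]
    exact continuous_poissonKerDeriv hr
  exact h.contDiffOn.absolutelyContinuousOnInterval

theorem poissonKer_pi {r : ℝ} (hr : r ∈ Ioo (0 : ℝ) 1) :
    poissonKer r Real.pi = (1 - r) / (1 + r) := by
  have : 1 + r ≠ 0 := by linarith [hr.1]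
  rw [poissonKer, Real.cos_pi, show 1 - 2 * r * -1 + r ^ 2 = (1 + r) ^ 2 by ring]
  field_simp
  ring

theorem poissonKer_neg (r s : ℝ) : poissonKer r (-s) = poissonKer r s := by
  simp [poissonKer]

/-- The integral of `-s P'(s)` is at most that of `P`. -/
theorem integral_neg_mul_poissonKerDeriv_le {r : ℝ} (hr : r ∈ Ioo (0 : ℝ) 1) :
    ∫ s in (-Real.pi)..Real.pi, -(s * poissonKerDeriv r s) ≤
      ∫ s in (-Real.pi)..Real.pi, poissonKer r s := by
  have h := intervalIntegral.integral_mul_deriv_eq_deriv_mul (a := -Real.pi) (b := Real.pi)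
    (u := fun s => s) (u' := fun _ => 1) (v := poissonKer r) (v' := poissonKerDeriv r)
    (fun s _ => hasDerivAt_id s) (fun s _ => hasDerivAt_poissonKer hr s)
    (by simp) ((continuous_poissonKerDeriv hr).intervalIntegrable _ _)
  rw [intervalIntegral.integral_neg, h, poissonKer_neg, poissonKer_pi hr]
  have : 0 ≤ (1 - r) / (1 + r) := div_nonneg (by linarith [hr.2]) (by linarith [hr.1])
  have := mul_nonneg Real.pi_pos.le this
  simp only [one_mul]
  linarith

theorem mul_poissonKerDeriv_nonpos {r : ℝ} (hr : r ∈ Ioo (0 : ℝ) 1) {s : ℝ}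
    (hs : s ∈ Icc (-Real.pi) Real.pi) : s * poissonKerDeriv r s ≤ 0 := by
  have hss : 0 ≤ s * Real.sin s := by
    rcases le_total 0 s with h | h
    · exact mul_nonneg h (Real.sin_nonneg_of_nonneg_of_le_pi h hs.2)
    · exact mul_nonneg_of_nonpos_of_nonpos h (Real.sin_nonpos_of_nonpos_of_neg_pi_le h hs.1)
  have h1 : 0 ≤ 1 - r ^ 2 := by nlinarith [hr.1, hr.2]
  have : s * poissonKerDeriv r s =
      -(((1 - r ^ 2) * (2 * r * (s * Real.sin s))) / (1 - 2 * r * Real.cos s + r ^ 2) ^ 2) := by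
    rw [poissonKerDeriv]; ring
  rw [this, neg_nonpos]
  have := hr.1
  positivity

/-- Away from `0` the denominator of the kernel is at least `2r(1 - cos δ) ≥ 1 - cos δ`, which is
where `1 / 2 ≤ r` enters; the numerator carries the factor `1 - r² ≤ 2(1 - r)`. -/
theorem abs_poissonKerDeriv_le {r : ℝ} (hr : r ∈ Ioo (0 : ℝ) 1) (hr2 : 1 / 2 ≤ r) {δ s : ℝ}
    (hδ : 0 < δ) (hδs : δ ≤ |s|) (hs : |s| ≤ Real.pi) :
    |poissonKerDeriv r s| ≤ 4 * (1 - r) / (1 - Real.cos δ) ^ 2 := by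
  have hcos : Real.cos s ≤ Real.cos δ := by
    rw [← Real.cos_abs s]
    exact Real.cos_le_cos_of_nonneg_of_le_pi hδ.le hs hδs
  have hd : 0 < 1 - Real.cos δ := by
    have := Real.cos_lt_cos_of_nonneg_of_le_pi le_rfl (hδs.trans hs) hδ
    rw [Real.cos_zero] at this
    linarith
  have hden : 1 - Real.cos δ ≤ 1 - 2 * r * Real.cos s + r ^ 2 := by
    rw [poissonKer_denom_eq]
    nlinarith [sq_nonneg (1 - r)]
  have hnum : |(1 - r ^ 2) * (2 * r * Real.sin s)| ≤ 4 * (1 - r) := by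
    rw [abs_mul, abs_mul, abs_of_nonneg (by nlinarith [hr.1, hr.2] : 0 ≤ 1 - r ^ 2),
      abs_of_nonneg (by linarith [hr.1] : 0 ≤ 2 * r)]
    have hs1 := Real.abs_sin_le_one s
    have h2 : 2 * r * |Real.sin s| ≤ 2 := by nlinarith [abs_nonneg (Real.sin s), hr.1, hr.2]
    have h3 : 1 - r ^ 2 ≤ 2 * (1 - r) := by nlinarith [hr.1, hr.2]
    calc (1 - r ^ 2) * (2 * r * |Real.sin s|) ≤ (2 * (1 - r)) * 2 := by
          apply mul_le_mul h3 h2 _ (by linarith [hr.2])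
          exact mul_nonneg (by linarith [hr.1]) (abs_nonneg _)
      _ = 4 * (1 - r) := by ring
  rw [poissonKerDeriv, abs_div, abs_neg, abs_of_pos (pow_pos (poissonKer_denom_pos hr s) 2)]
  have := (abs_nonneg _).trans hnum
  gcongr

/-- Integrals of a locally integrable function against the Poisson kernel converge at every point
at which its primitive is differentiable. -/
theorem tendsto_integral_poissonKer_mul {f : ℝ → ℝ} (hf : ∀ a b, IntervalIntegrable f volume a b)
    {t L : ℝ} (hL : HasDerivAt (fun x => ∫ s in (0 : ℝ)..x, f s) L t)
    (hP : ∀ r ∈ Ioo (0 : ℝ) 1, ∫ s in (-Real.pi)..Real.pi, poissonKer r s = 2 * Real.pi) :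
    Tendsto (fun r => ∫ s in (-Real.pi)..Real.pi, poissonKer r s * f (t + s)) (𝓝[<] 1)
      (𝓝 (2 * Real.pi * L)) := by
  set g : ℝ → ℝ := fun s => f (t + s) - L with hg
  have hft : ∀ a b, IntervalIntegrable (fun s => f (t + s)) volume a b := fun a b => by
    simpa using (hf (t + a) (t + b)).comp_add_left t
  have hgi : ∀ a b, IntervalIntegrable g volume a b := fun a b => (hft a b).sub (by simp)
  -- Differentiability of the primitive of `f` at `t` with derivative `L` says exactly that `E s =
  -- o(s)` at `0`. This is all that is needed about `f` near `t`.
  set E : ℝ → ℝ := fun s => ∫ u in (0 : ℝ)..s, g u with hE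
  have hE0 : HasDerivAt E 0 0 := by
    have h1 : E = fun s => (∫ u in (0 : ℝ)..(t + s), f u) - (∫ u in (0 : ℝ)..t, f u) - s * L := by
      funext s
      simp only [hE, hg]
      rw [intervalIntegral.integral_sub (hft _ _) (by simp),
        intervalIntegral.integral_comp_add_left (f := f),
        intervalIntegral.integral_interval_sub_left (hf _ _) (hf _ _)]
      simp
    rw [h1]
    have h2 : HasDerivAt (fun s => ∫ u in (0 : ℝ)..(t + s), f u) L 0 := by
      have : HasDerivAt (fun x => ∫ s in (0 : ℝ)..x, f s) L (t + 0) := by simpa using hL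
      simpa using this.comp_const_add t 0
    exact ((h2.sub_const (∫ u in (0 : ℝ)..t, f u)).sub
      ((hasDerivAt_id (0 : ℝ)).mul_const L)).congr_deriv (by ring)
  have hEcont : Continuous E := intervalIntegral.continuous_primitive hgi 0
  have hπ : (0 : ℝ) ∈ uIcc (-Real.pi) Real.pi := by
    rw [uIcc_of_le (by linarith [Real.pi_pos])]; constructor <;> linarith [Real.pi_pos]
  have hEac : AbsolutelyContinuousOnInterval E (-Real.pi) Real.pi :=
    (hgi _ _).absolutelyContinuousOnInterval_intervalIntegral hπ
  have hEd : ∀ᵐ s, s ∈ uIcc (-Real.pi) Real.pi → HasDerivAt E (g s) s := by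
    filter_upwards [(hgi (-Real.pi) Real.pi).ae_hasDerivAt_integral] with s hs h
    exact hs h 0 hπ
  obtain ⟨M, hM⟩ := isCompact_Icc.exists_bound_of_continuousOn
    (hEcont.continuousOn (s := Icc (-Real.pi) Real.pi))
  have hM0 : 0 ≤ M := (norm_nonneg _).trans (hM 0 (by
    constructor <;> linarith [Real.pi_pos]))
  -- Integration by parts moves the derivative from `E` to the kernel. As `E' = g` holds only almost
  -- everywhere, the version for absolutely continuous functions is used. The boundary term has the
  -- factor `P(±π) = (1 - r)/(1 + r)`.
  have hkey : ∀ r ∈ Ioo (0 : ℝ) 1, (∫ s in (-Real.pi)..Real.pi, poissonKer r s * f (t + s)) -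
      2 * Real.pi * L = (1 - r) / (1 + r) * (E Real.pi - E (-Real.pi)) -
        ∫ s in (-Real.pi)..Real.pi, poissonKerDeriv r s * E s := by
    intro r hr
    have h1 : ∫ s in (-Real.pi)..Real.pi, poissonKer r s * g s =
        ∫ s in (-Real.pi)..Real.pi, poissonKer r s * deriv E s := by
      apply intervalIntegral.integral_congr_ae
      filter_upwards [hEd] with s hs h
      rw [(hs (uIoc_subset_uIcc h)).deriv]
    have h2 := (absolutelyContinuousOnInterval_poissonKer hr (-Real.pi)
      Real.pi).integral_mul_deriv_eq_deriv_mul hEac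
    have h3 : ∀ s, deriv (poissonKer r) s = poissonKerDeriv r s :=
      fun s => (hasDerivAt_poissonKer hr s).deriv
    simp only [h3] at h2
    have h4 : ∫ s in (-Real.pi)..Real.pi, poissonKer r s * g s =
        (∫ s in (-Real.pi)..Real.pi, poissonKer r s * f (t + s)) - 2 * Real.pi * L := by
      simp only [hg, mul_sub]
      rw [intervalIntegral.integral_sub
        ((hft _ _).continuousOn_mul (continuous_poissonKer hr).continuousOn)
        (g := fun s => poissonKer r s * L)
        (((continuous_poissonKer hr).mul continuous_const).intervalIntegrable _ _),
        intervalIntegral.integral_mul_const, hP r hr]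
    rw [← h4, h1, h2, poissonKer_neg, poissonKer_pi hr]
    ring
  rw [← tendsto_sub_nhds_zero_iff]
  rw [Metric.tendsto_nhds]
  intro ε hε
  obtain ⟨η, hη, hηε⟩ : ∃ η : ℝ, 0 < η ∧ 2 * Real.pi * η < ε / 2 :=
    ⟨ε / (8 * Real.pi), by positivity, by field_simp; norm_num⟩
  have hlittle := hE0.isLittleO.def hη
  obtain ⟨δ, hδ, hδE⟩ := Metric.eventually_nhds_iff.1 hlittle
  have hEzero : E 0 = 0 := by simp [hE]
  simp only [hEzero, sub_zero, smul_zero, Real.dist_eq, Real.norm_eq_abs] at hδE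
  -- For `|s| < δ'` the bound `|E s| ≤ η |s|` leaves `η · (-s P'(s))`, whose integral is at most
  -- `2πη`. For `|s| ≥ δ'` the derivative of the kernel is `O(1 - r)` and `E` is bounded by `M`. The
  -- constant `K` collects this part and the boundary term.
  set δ' := min (δ / 2) 1 with hδ'
  have hδ'0 : 0 < δ' := lt_min (by linarith) one_pos
  set K := 2 * M + 2 * Real.pi * (4 / (1 - Real.cos δ') ^ 2 * M) with hK
  have hbound : ∀ r ∈ Ioo (0 : ℝ) 1, 1 / 2 ≤ r →
      |(∫ s in (-Real.pi)..Real.pi, poissonKer r s * f (t + s)) - 2 * Real.pi * L| ≤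
        2 * Real.pi * η + (1 - r) * K := by
    intro r hr hr2
    have hπ' : -Real.pi ≤ Real.pi := by linarith [Real.pi_pos]
    rw [hkey r hr]
    have hA : |(1 - r) / (1 + r) * (E Real.pi - E (-Real.pi))| ≤ (1 - r) * (2 * M) := by
      rw [abs_mul]
      have h1 : |(1 - r) / (1 + r)| ≤ 1 - r := by
        rw [abs_of_nonneg (div_nonneg (by linarith [hr.2]) (by linarith [hr.1]))]
        exact div_le_self (by linarith [hr.2]) (by linarith [hr.1])
      have h2 : |E Real.pi - E (-Real.pi)| ≤ 2 * M := by
        have e1 := hM Real.pi ⟨hπ', le_rfl⟩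
        have e2 := hM (-Real.pi) ⟨le_rfl, hπ'⟩
        rw [Real.norm_eq_abs] at e1 e2
        have := abs_sub (E Real.pi) (E (-Real.pi))
        linarith
      exact mul_le_mul h1 h2 (abs_nonneg _) (by linarith [hr.2])
    have hB : |∫ s in (-Real.pi)..Real.pi, poissonKerDeriv r s * E s| ≤
        ∫ s in (-Real.pi)..Real.pi, (η * -(s * poissonKerDeriv r s) +
          (1 - r) * (4 / (1 - Real.cos δ') ^ 2 * M)) := by
      rw [← Real.norm_eq_abs]
      refine intervalIntegral.norm_integral_le_of_norm_le hπ' ?_ ?_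
      · filter_upwards with s hs
        have hs' : s ∈ Icc (-Real.pi) Real.pi := ⟨hs.1.le, hs.2⟩
        have hneg := mul_poissonKerDeriv_nonpos hr hs'
        rw [Real.norm_eq_abs, abs_mul]
        rcases lt_or_ge |s| δ' with h | h
        · have h1 : |E s| ≤ η * |s| := hδE (lt_of_lt_of_le h (by
            have := min_le_left (δ / 2) 1; linarith))
          have h2 : 0 ≤ (1 - r) * (4 / (1 - Real.cos δ') ^ 2 * M) := by
            have := hr.2
            have : 0 ≤ 1 - r := by linarith
            positivity
          calc |poissonKerDeriv r s| * |E s| ≤ |poissonKerDeriv r s| * (η * |s|) := by gcongr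
            _ = η * -(s * poissonKerDeriv r s) := by
              rw [← abs_of_nonpos hneg, abs_mul]; ring
            _ ≤ _ := by linarith
        · have h1 := abs_poissonKerDeriv_le hr hr2 hδ'0 h (abs_le.2 ⟨hs'.1, hs'.2⟩)
          have h2 : 0 ≤ η * -(s * poissonKerDeriv r s) := mul_nonneg hη.le (by linarith)
          calc |poissonKerDeriv r s| * |E s|
              ≤ (4 * (1 - r) / (1 - Real.cos δ') ^ 2) * M :=
                mul_le_mul h1 (hM s hs') (abs_nonneg _) ((abs_nonneg _).trans h1)
            _ = (1 - r) * (4 / (1 - Real.cos δ') ^ 2 * M) := by ring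
            _ ≤ _ := by linarith
      · have := continuous_poissonKerDeriv hr
        exact Continuous.intervalIntegrable (by fun_prop) _ _
    rw [intervalIntegral.integral_add, intervalIntegral.integral_const_mul,
      intervalIntegral.integral_const] at hB
    · have hI := integral_neg_mul_poissonKerDeriv_le hr
      rw [hP r hr] at hI
      have hI' := mul_le_mul_of_nonneg_left hI hη.le
      have h1 := abs_sub ((1 - r) / (1 + r) * (E Real.pi - E (-Real.pi)))
        (∫ s in (-Real.pi)..Real.pi, poissonKerDeriv r s * E s)
      rw [smul_eq_mul] at hB
      rw [hK]
      linarith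
    · have := continuous_poissonKerDeriv hr
      exact Continuous.intervalIntegrable (by fun_prop) _ _
    · simp
  have hlim : Tendsto (fun r : ℝ => 2 * Real.pi * η + (1 - r) * K) (𝓝[<] 1)
      (𝓝 (2 * Real.pi * η)) := by
    have : Continuous fun r : ℝ => 2 * Real.pi * η + (1 - r) * K := by fun_prop
    simpa using (this.tendsto 1).mono_left nhdsWithin_le_nhds
  have h3 : Ioo (1 / 2 : ℝ) 1 ∈ 𝓝[<] (1 : ℝ) := Ioo_mem_nhdsLT (by norm_num)
  filter_upwards [hlim.eventually_lt_const (by linarith : 2 * Real.pi * η < ε), h3] with r h4 h5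
  rw [Real.dist_eq, sub_zero]
  exact (hbound r ⟨by linarith [h5.1], h5.2⟩ h5.1.le).trans_lt h4

/-! ### The complex Hardy space: boundary functions -/

/-- `F` is a `2π`-periodic locally integrable function whose Fourier coefficients of nonnegative
index are `c`, those of negative index being zero. -/
structure HasHardyCoeffs (F : ℝ → ℂ) (c : ℕ → ℂ) : Prop where
  periodic : Function.Periodic F (2 * Real.pi)
  integrable : ∀ a b, IntervalIntegrable F volume a b
  coeff : ∀ n : ℕ, ∫ s in (-Real.pi)..Real.pi, Complex.exp (-(n * s * Complex.I)) * F s =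
    2 * Real.pi * c n
  coeff_neg : ∀ n : ℕ, ∫ s in (-Real.pi)..Real.pi, Complex.exp ((n + 1 : ℕ) * s * Complex.I) * F s = 0

/-- Riesz–Fischer: extend `c` by zero to negative indices, take the preimage under the Fourier
isometry of `L²` of the circle, and pull it back to the line. -/
theorem exists_hasHardyCoeffs (c : ℕ → ℂ) (hc : Summable fun n => ‖c n‖ ^ 2) :
    ∃ F : ℝ → ℂ, HasHardyCoeffs F c ∧ MemLp F 2 (volume.restrict (Ioc (-Real.pi) Real.pi)) ∧
      ∫ s in (-Real.pi)..Real.pi, ‖F s‖ ^ 2 = 2 * Real.pi * ∑' n, ‖c n‖ ^ 2 := by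
  have : Fact (0 < 2 * Real.pi) := ⟨Real.two_pi_pos⟩
  let d : ℤ → ℂ := fun k => if 0 ≤ k then c k.toNat else 0
  have hd : ∀ n : ℕ, d n = c n := fun n => by simp [d]
  have hdneg : ∀ n : ℕ, d (-((n + 1 : ℕ) : ℤ)) = 0 := fun n => by
    simp only [d]; rw [if_neg (by omega)]
  have hinj : Function.Injective (fun n : ℕ => (n : ℤ)) := Nat.cast_injective
  have hsupp : ∀ k : ℤ, k ∉ range (fun n : ℕ => (n : ℤ)) → ‖d k‖ ^ 2 = 0 := by
    intro k hk
    have : ¬ 0 ≤ k := fun h => hk ⟨k.toNat, by simp [h]⟩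
    simp [d, this]
  have hds : HasSum (fun k => ‖d k‖ ^ 2) (∑' n, ‖c n‖ ^ 2) := by
    rw [← hinj.hasSum_iff hsupp]
    simpa only [Function.comp_def, hd] using hc.hasSum
  have hmem : Memℓp d 2 := by
    apply memℓp_gen
    simpa using hds.summable
  let φ : Lp ℂ 2 (@AddCircle.haarAddCircle (2 * Real.pi) _) := fourierBasis.repr.symm ⟨d, hmem⟩
  have hφ : ∀ k, fourierCoeff φ k = d k := fun k => by
    rw [← fourierBasis_repr]
    simp [φ]
  have hφ2 : MemLp φ 2 (volume : Measure (AddCircle (2 * Real.pi))) :=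
    memLp_haarAddCircle_iff.1 (Lp.memLp φ)
  have hπ : -Real.pi + 2 * Real.pi = Real.pi := by ring
  let F : ℝ → ℂ := fun s => φ (s : AddCircle (2 * Real.pi))
  have hF2 : MemLp F 2 (volume.restrict (Ioc (-Real.pi) Real.pi)) := by
    have := hφ2.comp_measurePreserving (AddCircle.measurePreserving_mk (2 * Real.pi) (-Real.pi))
    rwa [hπ] at this
  have hFper : Function.Periodic F (2 * Real.pi) := fun s => by
    simp only [F]; rw [AddCircle.coe_add_period]
  have hcoef : ∀ k : ℤ, ∫ s in (-Real.pi)..Real.pi, Complex.exp (-(k * s * Complex.I)) * F s =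
      2 * Real.pi * d k := by
    intro k
    have h := fourierCoeff_eq_intervalIntegral (φ : AddCircle (2 * Real.pi) → ℂ) k (-Real.pi)
    rw [hφ, hπ] at h
    rw [h, Complex.real_smul]
    have hpi : (Real.pi : ℂ) ≠ 0 := by exact_mod_cast Real.pi_ne_zero
    push_cast
    rw [← mul_assoc, mul_one_div_cancel (by simp), one_mul]
    apply intervalIntegral.integral_congr
    intro s _
    simp only [F, smul_eq_mul]
    rw [fourier_coe_apply]
    congr 2
    push_cast
    field_simp
  refine ⟨F, ⟨hFper, ?_, fun n => ?_, fun n => ?_⟩, hF2, ?_⟩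
  · refine hFper.intervalIntegrable (t := -Real.pi) Real.two_pi_pos.ne' ?_
    rw [hπ, intervalIntegrable_iff_integrableOn_Ioc_of_le (by linarith [Real.pi_pos])]
    exact hF2.integrable (by norm_num)
  · have := hcoef n
    rw [hd] at this
    simpa using this
  · have := hcoef (-((n + 1 : ℕ) : ℤ))
    rw [hdneg, mul_zero] at this
    rw [← this]
    congr 1
    funext s
    congr 2
    push_cast
    ring
  · have h1 := (hasSum_sq_fourierCoeff φ).unique (by simpa only [hφ] using hds)
    rw [AddCircle.integral_haarAddCircle, ← AddCircle.intervalIntegral_preimage _ (-Real.pi),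
      hπ, smul_eq_mul] at h1
    rw [← h1, mul_inv_cancel_left₀ Real.two_pi_pos.ne']

theorem summable_mul_pow_of_summable_sq {c : ℕ → ℂ} (hc : Summable fun n => ‖c n‖ ^ 2) {z : ℂ}
    (hz : ‖z‖ < 1) : Summable fun n => ‖c n * z ^ n‖ := by
  have h2 : Summable fun n => (‖z‖ ^ n) ^ 2 := by
    simp only [← pow_mul, mul_comm _ 2]
    simp only [pow_mul]
    exact summable_geometric_of_lt_one (by positivity) (by nlinarith [norm_nonneg z])
  refine (hc.add h2).of_nonneg_of_le (fun n => norm_nonneg _) fun n => ?_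
  rw [norm_mul, norm_pow]
  nlinarith [sq_nonneg (‖c n‖ - ‖z‖ ^ n), sq_nonneg (‖c n‖), sq_nonneg (‖z‖ ^ n)]

/-- The sum of the complex power series with coefficients `c`. -/
noncomputable def powerSum (c : ℕ → ℂ) (z : ℂ) : ℂ := ∑' n, c n * z ^ n

theorem continuousOn_powerSum {c : ℕ → ℂ} (hc : Summable fun n => ‖c n‖ ^ 2) :
    ContinuousOn (powerSum c) (ball 0 1) := by
  intro z hz
  rw [mem_ball_zero_iff] at hz
  obtain ⟨ρ, h1, h2⟩ := exists_between hz
  have hρ : ‖(ρ : ℂ)‖ = ρ := by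
    rw [Complex.norm_real, Real.norm_eq_abs, abs_of_nonneg ((norm_nonneg z).trans h1.le)]
  have : ContinuousOn (powerSum c) (ball 0 ρ) := by
    refine continuousOn_tsum (fun n => by fun_prop)
      (summable_mul_pow_of_summable_sq hc (z := ρ) (by rwa [hρ])) fun n w hw => ?_
    rw [norm_mul, norm_mul, norm_pow, norm_pow, hρ]
    rw [mem_ball_zero_iff] at hw
    gcongr
  exact (this.continuousAt (isOpen_ball.mem_nhds (by simpa using h1))).continuousWithinAt

/-- Rotation invariance: it reduces the Poisson formula at `r e^{it}` to the formula at the real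
point `r`. -/
theorem HasHardyCoeffs.comp_add_left {F : ℝ → ℂ} {c : ℕ → ℂ} (h : HasHardyCoeffs F c) (t : ℝ) :
    HasHardyCoeffs (fun s => F (t + s)) fun n => c n * Complex.exp (t * Complex.I) ^ n := by
  have key : ∀ k : ℤ, ∫ s in (-Real.pi)..Real.pi, Complex.exp (k * s * Complex.I) * F (t + s) =
      Complex.exp (-(k * t * Complex.I)) *
        ∫ s in (-Real.pi)..Real.pi, Complex.exp (k * s * Complex.I) * F s := by
    intro k
    have hper : Function.Periodic (fun s : ℝ => Complex.exp (k * s * Complex.I) * F s)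
        (2 * Real.pi) := by
      intro s
      simp only
      rw [h.periodic s]
      congr 1
      rw [Complex.exp_eq_exp_iff_exists_int]
      exact ⟨k, by push_cast; ring⟩
    have h1 := hper.intervalIntegral_add_eq (t + -Real.pi) (-Real.pi)
    rw [show t + -Real.pi + 2 * Real.pi = t + Real.pi by ring,
      show -Real.pi + 2 * Real.pi = Real.pi by ring] at h1
    rw [← h1, ← intervalIntegral.integral_comp_add_left
      (f := fun s : ℝ => Complex.exp (k * s * Complex.I) * F s),
      ← intervalIntegral.integral_const_mul]
    apply intervalIntegral.integral_congr
    intro s _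
    simp only
    rw [← mul_assoc, ← Complex.exp_add]
    congr 2
    push_cast
    ring
  refine ⟨fun s => ?_, fun a b => ?_, fun n => ?_, fun n => ?_⟩
  · rw [← add_assoc, h.periodic]
  · simpa using (h.integrable (t + a) (t + b)).comp_add_left t
  · have h1 := key (-(n : ℤ))
    have h2 := h.coeff n
    simp only [Int.cast_neg, Int.cast_natCast, neg_mul, neg_neg] at h1
    rw [h1, h2, ← Complex.exp_nat_mul]
    ring_nf
  · have h1 := key ((n + 1 : ℕ) : ℤ)
    have h2 := h.coeff_neg n
    simp only [Int.cast_natCast] at h1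
    rw [h1, h2, mul_zero]

/-- Two geometric series, in `r e^{-is}` and `r e^{is}`. The frequency `-n` is paired with `n + 1`,
so that each frequency occurs once and the summands match the fields `coeff` and `coeff_neg`. -/
theorem hasSum_poissonKer {r : ℝ} (hr : r ∈ Ioo (0 : ℝ) 1) (s : ℝ) :
    HasSum (fun n : ℕ => (r : ℂ) ^ n * Complex.exp (-(n * s * Complex.I)) +
      (r : ℂ) ^ (n + 1) * Complex.exp ((n + 1 : ℕ) * s * Complex.I)) (poissonKer r s) := by
  set z : ℂ := r * Complex.exp (s * Complex.I) with hz
  set w : ℂ := r * Complex.exp (-(s * Complex.I)) with hw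
  have hzn : ‖z‖ < 1 := by
    rw [hz, norm_mul, Complex.norm_exp_ofReal_mul_I, mul_one, Complex.norm_real, Real.norm_eq_abs,
      abs_of_pos hr.1]
    exact hr.2
  have hwn : ‖w‖ < 1 := by
    rw [hw, norm_mul, ← neg_mul, ← Complex.ofReal_neg, Complex.norm_exp_ofReal_mul_I, mul_one,
      Complex.norm_real, Real.norm_eq_abs, abs_of_pos hr.1]
    exact hr.2
  have h1 := (hasSum_geometric_of_norm_lt_one hwn).add
    ((hasSum_geometric_of_norm_lt_one hzn).mul_left z)
  have hz1 : 1 - z ≠ 0 := fun h => by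
    rw [← sub_eq_zero.1 h] at hzn; simp at hzn
  have hw1 : 1 - w ≠ 0 := fun h => by
    rw [← sub_eq_zero.1 h] at hwn; simp at hwn
  have hzw : z * w = r ^ 2 := by
    rw [hz, hw, show (r * Complex.exp (s * Complex.I)) * (r * Complex.exp (-(s * Complex.I))) =
      r ^ 2 * (Complex.exp (s * Complex.I) * Complex.exp (-(s * Complex.I))) by ring,
      ← Complex.exp_add, add_neg_cancel, Complex.exp_zero, mul_one]
  have hsum : z + w = 2 * r * Complex.cos s := by
    rw [hz, hw, Complex.cos, ← neg_mul]
    ring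
  have hval : (1 - w)⁻¹ + z * (1 - z)⁻¹ = (poissonKer r s : ℂ) := by
    have hden : (1 - z) * (1 - w) = ((1 - 2 * r * Real.cos s + r ^ 2 : ℝ) : ℂ) := by
      push_cast
      linear_combination -hsum + hzw
    rw [poissonKer, Complex.ofReal_div, ← hden]
    field_simp
    push_cast
    linear_combination -hzw
  rw [hval] at h1
  have h2 : (fun n : ℕ => w ^ n + z * z ^ n) = fun n : ℕ =>
      (r : ℂ) ^ n * Complex.exp (-(n * s * Complex.I)) +
        (r : ℂ) ^ (n + 1) * Complex.exp ((n + 1 : ℕ) * s * Complex.I) := by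
    funext n
    rw [hw, hz, mul_pow, ← Complex.exp_nat_mul, ← pow_succ', mul_pow, ← Complex.exp_nat_mul]
    congr 3 <;> ring
  rwa [h2] at h1

/-- Poisson representation at a real point: in the expansion of the kernel the frequencies `-n` pick
out `2π c n` and the positive ones integrate to zero against `F`. The terms are dominated by `2 rⁿ
‖F‖`, which justifies termwise integration. -/
theorem HasHardyCoeffs.integral_poissonKer_mul {F : ℝ → ℂ} {c : ℕ → ℂ} (h : HasHardyCoeffs F c)
    {r : ℝ} (hr : r ∈ Ioo (0 : ℝ) 1) :
    ∫ s in (-Real.pi)..Real.pi, (poissonKer r s : ℂ) * F s = 2 * Real.pi * powerSum c r := by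
  have hπ : -Real.pi ≤ Real.pi := by linarith [Real.pi_pos]
  have hint : ∀ (k : ℂ → ℂ), Continuous k → IntervalIntegrable
      (fun s : ℝ => k s * F s) volume (-Real.pi) Real.pi := fun k hk =>
    (h.integrable _ _).continuousOn_mul (by fun_prop)
  set G : ℕ → ℝ → ℂ := fun n s => ((r : ℂ) ^ n * Complex.exp (-(n * s * Complex.I)) +
      (r : ℂ) ^ (n + 1) * Complex.exp ((n + 1 : ℕ) * s * Complex.I)) * F s with hG
  have hGi : ∀ n, IntervalIntegrable (G n) volume (-Real.pi) Real.pi := fun n =>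
    hint (fun s => (r : ℂ) ^ n * Complex.exp (-(n * s * Complex.I)) +
      (r : ℂ) ^ (n + 1) * Complex.exp ((n + 1 : ℕ) * s * Complex.I)) (by fun_prop)
  have hGint : ∀ n, ∫ s in (-Real.pi)..Real.pi, G n s = 2 * Real.pi * (c n * (r : ℂ) ^ n) := by
    intro n
    simp only [hG, add_mul, mul_assoc]
    rw [intervalIntegral.integral_add, intervalIntegral.integral_const_mul,
      intervalIntegral.integral_const_mul]
    · have h1 := h.coeff n
      have h2 := h.coeff_neg n
      simp only [mul_assoc] at h1 h2
      rw [h1, h2]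
      ring
    · simpa only [mul_assoc] using
        (hint (fun s => Complex.exp (-(n * s * Complex.I))) (by fun_prop)).const_mul _
    · simpa only [mul_assoc] using
        (hint (fun s => Complex.exp ((n + 1 : ℕ) * s * Complex.I)) (by fun_prop)).const_mul _
  have hle : ∀ n s, ‖G n s‖ ≤ 2 * r ^ n * ‖F s‖ := by
    intro n s
    rw [hG, norm_mul]
    gcongr
    refine (norm_add_le _ _).trans ?_
    have e1 : ‖Complex.exp (-(n * s * Complex.I))‖ = 1 := by
      rw [← neg_mul]; exact_mod_cast Complex.norm_exp_ofReal_mul_I (-(n * s))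
    have e2 : ‖Complex.exp ((n + 1 : ℕ) * s * Complex.I)‖ = 1 := by
      exact_mod_cast Complex.norm_exp_ofReal_mul_I ((n + 1 : ℕ) * s)
    rw [norm_mul, norm_mul, e1, e2, norm_pow, norm_pow, Complex.norm_real, Real.norm_eq_abs,
      abs_of_pos hr.1, pow_succ]
    have := pow_pos hr.1 n
    nlinarith [hr.2]
  have hsum : Summable fun n => ∫ s in Ioc (-Real.pi) Real.pi, ‖G n s‖ := by
    refine Summable.of_nonneg_of_le (fun n => integral_nonneg fun s => norm_nonneg _) (fun n => ?_)
      (((summable_geometric_of_lt_one hr.1.le hr.2).mul_left 2).mul_right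
        (∫ s in Ioc (-Real.pi) Real.pi, ‖F s‖))
    rw [← integral_const_mul]
    exact integral_mono (hGi n).1.norm ((h.integrable _ _).1.norm.const_mul _) (hle n)
  have h1 := hasSum_integral_of_summable_integral_norm (fun n => (hGi n).1) hsum
  simp only [← intervalIntegral.integral_of_le hπ, hGint] at h1
  have h2 : ∀ s, ∑' n, G n s = (poissonKer r s : ℂ) * F s := fun s =>
    ((hasSum_poissonKer hr s).mul_right (F s)).tsum_eq
  simp only [h2] at h1
  rw [← h1.tsum_eq, tsum_mul_left, powerSum]

theorem hasHardyCoeffs_one : HasHardyCoeffs (fun _ => 1) (Pi.single 0 1) := by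
  have key : ∀ k : ℤ, k ≠ 0 → ∫ s in (-Real.pi)..Real.pi, Complex.exp (k * s * Complex.I) = 0 := by
    intro k hk
    have hk' : (k : ℂ) * Complex.I ≠ 0 := mul_ne_zero (by exact_mod_cast hk) Complex.I_ne_zero
    have := integral_exp_mul_complex (a := -Real.pi) (b := Real.pi) hk'
    simp only [mul_right_comm _ _ Complex.I] at this ⊢
    rw [this, div_eq_zero_iff, sub_eq_zero, Complex.exp_eq_exp_iff_exists_int]
    exact Or.inl ⟨k, by push_cast; ring⟩
  refine ⟨fun s => rfl, fun a b => by simp, fun n => ?_, fun n => ?_⟩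
  · rcases eq_or_ne n 0 with rfl | hn
    · simp; ring
    · have := key (-(n : ℤ)) (by simpa using hn)
      simp only [Int.cast_neg, Int.cast_natCast, neg_mul] at this
      simp [this, hn]
  · have := key ((n + 1 : ℕ) : ℤ) (by omega)
    simpa using this

/-- The Poisson representation of the constant `1`; it supplies the hypothesis `hP` of
`tendsto_integral_poissonKer_mul`. -/
theorem integral_poissonKer {r : ℝ} (hr : r ∈ Ioo (0 : ℝ) 1) :
    ∫ s in (-Real.pi)..Real.pi, poissonKer r s = 2 * Real.pi := by
  have h := hasHardyCoeffs_one.integral_poissonKer_mul hr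
  have h1 : powerSum (Pi.single 0 1) r = 1 := by
    rw [powerSum, tsum_eq_single 0 fun n hn => by simp [hn]]
    simp
  simp only [mul_one, h1, intervalIntegral.integral_ofReal] at h
  exact_mod_cast h

/-- **Fatou's theorem**: power series with square summable coefficients converge radially to
their boundary function almost everywhere. -/
theorem HasHardyCoeffs.ae_tendsto {F : ℝ → ℂ} {c : ℕ → ℂ} (h : HasHardyCoeffs F c) :
    ∀ᵐ t : ℝ, Tendsto (fun r : ℝ => powerSum c (r * Complex.exp (t * Complex.I))) (𝓝[<] 1)
      (𝓝 (F t)) := by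
  have hre : ∀ a b, IntervalIntegrable (fun s => (F s).re) volume a b := fun a b =>
    ⟨(h.integrable a b).1.re, (h.integrable a b).2.re⟩
  have him : ∀ a b, IntervalIntegrable (fun s => (F s).im) volume a b := fun a b =>
    ⟨(h.integrable a b).1.im, (h.integrable a b).2.im⟩
  have hloc : ∀ f : ℝ → ℝ, (∀ a b, IntervalIntegrable f volume a b) →
      LocallyIntegrable f volume := fun f hf => by
    intro x
    refine ⟨Ioc (x - 1) (x + 1), Ioc_mem_nhds (by linarith) (by linarith), ?_⟩
    exact (hf (x - 1) (x + 1)).1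
  -- By Lebesgue's differentiation theorem the primitives of the real and imaginary parts are
  -- differentiable at almost every `t`, with derivatives the values of `F`.
  filter_upwards [LocallyIntegrable.ae_hasDerivAt_integral (hloc _ hre),
    LocallyIntegrable.ae_hasDerivAt_integral (hloc _ him)]
    with t h1 h2
  have l1 := tendsto_integral_poissonKer_mul hre (h1 0) fun r hr => integral_poissonKer hr
  have l2 := tendsto_integral_poissonKer_mul him (h2 0) fun r hr => integral_poissonKer hr
  have l3 := ((Complex.continuous_ofReal.tendsto _).comp l1).add
    (((Complex.continuous_ofReal.tendsto _).comp l2).mul_const Complex.I)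
  have l4 := l3.const_mul (2 * Real.pi : ℂ)⁻¹
  have hpi : (2 * Real.pi : ℂ) ≠ 0 := by simp [Real.pi_ne_zero]
  have hlim : (2 * Real.pi : ℂ)⁻¹ * (((2 * Real.pi * (F t).re : ℝ) : ℂ) +
      ((2 * Real.pi * (F t).im : ℝ) : ℂ) * Complex.I) = F t := by
    conv_rhs => rw [← Complex.re_add_im (F t)]
    push_cast
    field_simp
  rw [hlim] at l4
  refine l4.congr' ?_
  filter_upwards [Ioo_mem_nhdsLT (show (0 : ℝ) < 1 by norm_num)] with r hr
  have h5 := (h.comp_add_left t).integral_poissonKer_mul hr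
  have h6 : powerSum (fun n => c n * Complex.exp (t * Complex.I) ^ n) r =
      powerSum c (r * Complex.exp (t * Complex.I)) := by
    simp only [powerSum, mul_pow]
    congr 1; funext n; ring
  rw [h6] at h5
  rw [eq_comm, ← mul_right_inj' hpi, ← h5, mul_inv_cancel_left₀ hpi]
  have hi : IntervalIntegrable (fun s => (poissonKer r s : ℂ) * F (t + s)) volume (-Real.pi)
      Real.pi := ((h.comp_add_left t).integrable _ _).continuousOn_mul
        (Complex.continuous_ofReal.comp (continuous_poissonKer hr)).continuousOn
  have e1 := Complex.reCLM.intervalIntegral_comp_comm hi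
  have e2 := Complex.imCLM.intervalIntegral_comp_comm hi
  simp only [Complex.reCLM_apply, Complex.imCLM_apply, Complex.re_ofReal_mul,
    Complex.im_ofReal_mul] at e1 e2
  simp only [Function.comp_apply]
  rw [e1, e2, Complex.re_add_im]

/-- Parseval's identity on circles of radius less than one. -/
theorem integral_norm_sq_powerSum {c : ℕ → ℂ} (hc : Summable fun n => ‖c n‖ ^ 2)
    {r : ℝ} (hr : r ∈ Ioo (0 : ℝ) 1) :
    ∫ t in (-Real.pi)..Real.pi, ‖powerSum c (r * Complex.exp (t * Complex.I))‖ ^ 2 =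
      2 * Real.pi * ∑' n, ‖c n * (r : ℂ) ^ n‖ ^ 2 := by
  have hcr : Summable fun n => ‖c n * (r : ℂ) ^ n‖ ^ 2 := by
    refine hc.of_nonneg_of_le (fun n => by positivity) fun n => ?_
    rw [norm_mul, norm_pow, Complex.norm_real, Real.norm_eq_abs, abs_of_pos hr.1, mul_pow]
    have h1 : (r ^ n) ^ 2 ≤ 1 := pow_le_one₀ (pow_nonneg hr.1.le _) (pow_le_one₀ hr.1.le hr.2.le)
    nlinarith [sq_nonneg ‖c n‖]
  -- The dilated coefficients `c n * rⁿ` have a boundary function `G` that obeys Parseval. Its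
  -- radial limits are taken inside the disc of `powerSum c`, so by continuity `G` agrees almost
  -- everywhere with `powerSum c` on the circle of radius `r`.
  obtain ⟨G, hG, -, hGn⟩ := exists_hasHardyCoeffs _ hcr
  rw [← hGn]
  apply intervalIntegral.integral_congr_ae
  filter_upwards [hG.ae_tendsto] with t ht _
  have hz : ‖(r : ℂ) * Complex.exp (t * Complex.I)‖ < 1 := by
    rw [norm_mul, Complex.norm_exp_ofReal_mul_I, mul_one, Complex.norm_real, Real.norm_eq_abs,
      abs_of_pos hr.1]
    exact hr.2
  have h1 : Tendsto (fun ρ : ℝ => powerSum c (ρ * (r * Complex.exp (t * Complex.I)))) (𝓝[<] 1)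
      (𝓝 (powerSum c (r * Complex.exp (t * Complex.I)))) := by
    have hcont : ContinuousAt (powerSum c) (((1 : ℝ) : ℂ) * (r * Complex.exp (t * Complex.I))) :=
      (continuousOn_powerSum hc).continuousAt (isOpen_ball.mem_nhds (by simpa using hz))
    have : ContinuousAt (fun ρ : ℝ => powerSum c (ρ * (r * Complex.exp (t * Complex.I)))) 1 :=
      hcont.comp (f := fun ρ : ℝ => (ρ : ℂ) * (r * Complex.exp (t * Complex.I)))
        (by fun_prop)
    simpa using this.tendsto.mono_left nhdsWithin_le_nhds
  have h2 : (fun ρ : ℝ => powerSum c (ρ * (r * Complex.exp (t * Complex.I)))) =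
      fun ρ : ℝ => powerSum (fun n => c n * (r : ℂ) ^ n) (ρ * Complex.exp (t * Complex.I)) := by
    funext ρ
    simp only [powerSum, mul_pow]
    congr 1; funext n; ring
  rw [h2] at h1
  rw [tendsto_nhds_unique h1 ht]

/-! ### Real coefficients and integrals over the half circle -/

theorem powerSum_conj (c : ℕ → ℝ) (z : ℂ) :
    powerSum (fun n => (c n : ℂ)) (starRingEnd ℂ z) =
      starRingEnd ℂ (powerSum (fun n => (c n : ℂ)) z) := by
  simp only [powerSum, Complex.conj_tsum, map_mul, map_pow, Complex.conj_ofReal]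

theorem powerSum_neg_angle (c : ℕ → ℝ) (r t : ℝ) :
    powerSum (fun n => (c n : ℂ)) (r * Complex.exp ((-t : ℝ) * Complex.I)) =
      starRingEnd ℂ (powerSum (fun n => (c n : ℂ)) (r * Complex.exp (t * Complex.I))) := by
  rw [← powerSum_conj, map_mul, ← Complex.exp_conj]
  simp

/-- The integral of a function with even norm over a half period. -/
theorem integral_norm_sq_half {F : ℝ → ℂ} (heven : ∀ᵐ t : ℝ, ‖F (-t)‖ = ‖F t‖)
    (hF : IntervalIntegrable (fun t => ‖F t‖ ^ 2) volume (-Real.pi) Real.pi) :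
    ∫ t in (-Real.pi)..Real.pi, ‖F t‖ ^ 2 = 2 * ∫ t in (0 : ℝ)..Real.pi, ‖F t‖ ^ 2 := by
  have hπ := Real.pi_pos
  have h1 : IntervalIntegrable (fun t => ‖F t‖ ^ 2) volume (-Real.pi) 0 :=
    hF.mono_set (by
      rw [uIcc_of_le (by linarith), uIcc_of_le (by linarith)]
      exact Icc_subset_Icc_right hπ.le)
  have h2 : IntervalIntegrable (fun t => ‖F t‖ ^ 2) volume 0 Real.pi :=
    hF.mono_set (by
      rw [uIcc_of_le (by linarith), uIcc_of_le (by linarith)]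
      exact Icc_subset_Icc_left (by linarith))
  have h3 : ∫ t in (0 : ℝ)..Real.pi, ‖F t‖ ^ 2 = ∫ t in (-Real.pi)..0, ‖F t‖ ^ 2 := by
    have := intervalIntegral.integral_comp_neg (a := 0) (b := Real.pi) fun t => ‖F t‖ ^ 2
    rw [neg_zero] at this
    rw [← this]
    apply intervalIntegral.integral_congr_ae
    filter_upwards [heven] with t ht _
    rw [ht]
  rw [← intervalIntegral.integral_add_adjacent_intervals h1 h2, ← h3]
  ring

theorem lintegral_norm_sq_eq {F : ℝ → ℂ} {C : ℝ} (heven : ∀ᵐ t : ℝ, ‖F (-t)‖ = ‖F t‖)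
    (hF : IntervalIntegrable (fun t => ‖F t‖ ^ 2) volume (-Real.pi) Real.pi)
    (hC : ∫ t in (-Real.pi)..Real.pi, ‖F t‖ ^ 2 = 2 * Real.pi * C) :
    ∫⁻ t in Icc 0 Real.pi, ENNReal.ofReal (‖F t‖ ^ 2) = ENNReal.ofReal (Real.pi * C) := by
  have hπ := Real.pi_pos
  rw [integral_norm_sq_half heven hF] at hC
  have h2 : IntervalIntegrable (fun t => ‖F t‖ ^ 2) volume 0 Real.pi :=
    hF.mono_set (by
      rw [uIcc_of_le (by linarith), uIcc_of_le (by linarith)]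
      exact Icc_subset_Icc_left (by linarith))
  rw [Measure.restrict_congr_set (Ioc_ae_eq_Icc (μ := volume)).symm,
    ← ofReal_integral_eq_lintegral_ofReal h2.1
    (ae_of_all _ fun t => by positivity), ← intervalIntegral.integral_of_le hπ.le]
  congr 1
  linarith

/-- The boundary function of a power series with real square summable coefficients. -/
theorem exists_boundaryFunction (c : ℕ → ℝ) (hc : Summable fun n => c n ^ 2) :
    ∃ F : ℝ → ℂ, AEStronglyMeasurable F (volume.restrict (Icc 0 Real.pi)) ∧
      (∀ᵐ t : ℝ, Tendsto (fun r : ℝ => powerSum (fun n => (c n : ℂ))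
        (r * Complex.exp (t * Complex.I))) (𝓝[<] 1) (𝓝 (F t))) ∧
      ∫⁻ t in Icc 0 Real.pi, ENNReal.ofReal (‖F t‖ ^ 2) =
        ENNReal.ofReal (Real.pi * ∑' n, c n ^ 2) := by
  have hn : ∀ n, ‖(c n : ℂ)‖ ^ 2 = c n ^ 2 := fun n => by
    rw [Complex.norm_real, Real.norm_eq_abs, sq_abs]
  obtain ⟨F, hF, hF2, hFn⟩ := exists_hasHardyCoeffs (fun n => (c n : ℂ)) (by simpa only [hn] using hc)
  have hπ := Real.pi_pos
  refine ⟨F, ?_, hF.ae_tendsto, ?_⟩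
  · rw [Measure.restrict_congr_set (Ioc_ae_eq_Icc (μ := volume)).symm]
    exact (hF.integrable 0 Real.pi).1.aestronglyMeasurable
  · simp only [hn] at hFn
    refine lintegral_norm_sq_eq ?_ ?_ hFn
    · have h1 := hF.ae_tendsto
      have h2 := (Measure.measurePreserving_neg (volume : Measure ℝ)).quasiMeasurePreserving.ae h1
      filter_upwards [h1, h2] with t h1 h2
      simp only [powerSum_neg_angle] at h2
      have h3 := (Complex.continuous_conj.tendsto _).comp h1
      rw [tendsto_nhds_unique h2 h3, Complex.norm_conj]
    · rw [intervalIntegrable_iff_integrableOn_Ioc_of_le (by linarith)]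
      exact hF2.integrable_norm_pow (by norm_num)

theorem continuous_powerSum_circle {c : ℕ → ℂ} (hc : Summable fun n => ‖c n‖ ^ 2) {r : ℝ}
    (hr : r ∈ Ioo (0 : ℝ) 1) :
    Continuous fun t : ℝ => powerSum c (r * Complex.exp (t * Complex.I)) := by
  refine (continuousOn_powerSum hc).comp_continuous (by fun_prop) fun t => ?_
  rw [mem_ball_zero_iff, norm_mul, Complex.norm_exp_ofReal_mul_I, mul_one, Complex.norm_real,
    Real.norm_eq_abs, abs_of_pos hr.1]
  exact hr.2

theorem lintegral_norm_sq_powerSum_le (c : ℕ → ℝ) (hc : Summable fun n => c n ^ 2) {r : ℝ}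
    (hr : r ∈ Ioo (0 : ℝ) 1) :
    ∫⁻ t in Icc 0 Real.pi, ENNReal.ofReal (‖powerSum (fun n => (c n : ℂ))
      (r * Complex.exp (t * Complex.I))‖ ^ 2) ≤ ENNReal.ofReal (Real.pi * ∑' n, c n ^ 2) := by
  have hn : ∀ n, ‖(c n : ℂ)‖ ^ 2 = c n ^ 2 := fun n => by
    rw [Complex.norm_real, Real.norm_eq_abs, sq_abs]
  have hc' : Summable fun n => ‖(c n : ℂ)‖ ^ 2 := by simpa only [hn] using hc
  have hcont := continuous_powerSum_circle hc' hr
  rw [lintegral_norm_sq_eq (ae_of_all _ fun t => by rw [powerSum_neg_angle, Complex.norm_conj])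
    ((hcont.norm.pow 2).intervalIntegrable _ _) (integral_norm_sq_powerSum hc' hr)]
  have hle : ∀ n, ‖(c n : ℂ) * (r : ℂ) ^ n‖ ^ 2 ≤ c n ^ 2 := fun n => by
    rw [norm_mul, norm_pow, Complex.norm_real, Complex.norm_real, Real.norm_eq_abs, Real.norm_eq_abs,
      abs_of_pos hr.1, mul_pow, sq_abs]
    have h1 : (r ^ n) ^ 2 ≤ 1 := pow_le_one₀ (pow_nonneg hr.1.le _) (pow_le_one₀ hr.1.le hr.2.le)
    nlinarith [sq_nonneg (c n)]
  have := Real.pi_pos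
  exact ENNReal.ofReal_le_ofReal (mul_le_mul_of_nonneg_left
    (Summable.tsum_le_tsum hle (hc.of_nonneg_of_le (fun n => by positivity) hle) hc) this.le)

/-! ### The density of the induced volume -/

theorem norm_sq_eq (q : ℍ[ℝ]) : ‖q‖ ^ 2 = q.re ^ 2 + q.imI ^ 2 + q.imJ ^ 2 + q.imK ^ 2 := by
  rw [← Quaternion.normSq_def', Quaternion.normSq_eq_norm_mul_self, sq]

/-- The second summand is `4|Im w|²`; thus the two coefficients of `g` agree exactly at real points.
-/
theorem norm_one_sub_sq (w : ℍ[ℝ]) :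
    ‖1 - w ^ 2‖ ^ 2 = (1 - ‖w‖ ^ 2) ^ 2 + 4 * (‖w‖ ^ 2 - w.re ^ 2) := by
  rw [norm_sq_eq, norm_sq_eq, sq w]
  simp only [Quaternion.re_sub, Quaternion.imI_sub, Quaternion.imJ_sub, Quaternion.imK_sub,
    Quaternion.re_mul, Quaternion.imI_mul, Quaternion.imJ_mul, Quaternion.imK_mul,
    Quaternion.re_one, Quaternion.imI_one, Quaternion.imJ_one, Quaternion.imK_one]
  ring

theorem slicePart_eq {w d u : ℍ[ℝ]} (hu : u ∈ slice w) (h1 : inner ℝ (d - u) 1 = 0)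
    (hw : inner ℝ (d - u) w = 0) : slicePart w d = u := by
  refine Submodule.eq_starProjection_of_mem_of_inner_eq_zero hu fun v hv => ?_
  obtain ⟨x, y, rfl⟩ := Submodule.mem_span_pair.1 hv
  rw [inner_add_right, inner_smul_right, inner_smul_right, h1, hw]
  simp

/-- Orthogonality of the projection removes the mixed terms, so that on an orthonormal frame only
the slice components remain to be computed. -/
theorem g_eq (w d e : ℍ[ℝ]) : g w d e =
    inner ℝ (slicePart w d) (slicePart w e) / (1 - ‖w‖ ^ 2) ^ 2 +
      (inner ℝ d e - inner ℝ (slicePart w d) (slicePart w e)) / ‖1 - w ^ 2‖ ^ 2 := by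
  have h1 : inner ℝ (d - slicePart w d) (slicePart w e) = 0 :=
    Submodule.starProjection_inner_eq_zero d _ (Submodule.starProjection_apply_mem _ _)
  have h2 : inner ℝ (e - slicePart w e) (slicePart w d) = 0 :=
    Submodule.starProjection_inner_eq_zero e _ (Submodule.starProjection_apply_mem _ _)
  have h3 : inner ℝ (d - slicePart w d) (e - slicePart w e) =
      inner ℝ d e - inner ℝ (slicePart w d) (slicePart w e) := by
    rw [inner_sub_left] at h2
    rw [inner_sub_right, h1, sub_zero, inner_sub_left, ← real_inner_comm (slicePart w d) e,
      sub_eq_zero.1 h2,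
      real_inner_comm (slicePart w d)]
  rw [g, h3]

/-- The Gram determinant of `g` on the frame, when the components of the frame in the slice are
given by a vector of the sphere, or vanish. -/
theorem det_g_frame {w : ℍ[ℝ]} (hw : w ≠ 0) (n : Fin 3 → ℝ)
    (hn : ∀ m k, inner ℝ (slicePart w (frame w m)) (slicePart w (frame w k)) = n m * n k) :
    (Matrix.of fun m k => g w (frame w m) (frame w k)).det =
      (‖1 - w ^ 2‖ ^ 2)⁻¹ ^ 2 * ((‖1 - w ^ 2‖ ^ 2)⁻¹ +
        (((1 - ‖w‖ ^ 2) ^ 2)⁻¹ - (‖1 - w ^ 2‖ ^ 2)⁻¹) * (n 0 ^ 2 + n 1 ^ 2 + n 2 ^ 2)) := by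
  -- With `α = 1/|1 - w²|²` and `β = 1/(1 - |w|²)²` the Gram matrix is the rank one perturbation `α
  -- · 1 + (β - α) n nᵀ`, of determinant `α²(α + (β - α)|n|²)`.
  have ho := orthonormal_iff_ite.1 (orthonormal_frame w hw).1
  rw [Matrix.det_fin_three]
  simp only [Matrix.of_apply, g_eq, hn, ho, div_eq_mul_inv]
  simp
  ring

theorem volDensity_eq {w : ℍ[ℝ]} (h0 : w ≠ 0) (h1 : ‖w‖ < 1) :
    volDensity w = ENNReal.ofReal (((1 - ‖w‖ ^ 2) *
      ((1 - ‖w‖ ^ 2) ^ 2 + 4 * (‖w‖ ^ 2 - w.re ^ 2)))⁻¹) := by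
  have hw : 0 < 1 - ‖w‖ ^ 2 := by nlinarith [norm_nonneg w]
  have hn0 : 0 < ‖w‖ := norm_pos_iff.2 h0
  have hnw := norm_sq_eq w
  rw [volDensity, ← norm_one_sub_sq]
  congr 1
  -- At a real point `slice w` is only `ℝ`, to which the whole frame is orthogonal; the determinant
  -- is computed with `n = 0`, and the two coefficients of `g` coincide.
  by_cases him : w.imI ^ 2 + w.imJ ^ 2 + w.imK ^ 2 = 0
  · have hI : w.imI = 0 := by nlinarith [sq_nonneg w.imI, sq_nonneg w.imJ, sq_nonneg w.imK]
    have hJ : w.imJ = 0 := by nlinarith [sq_nonneg w.imI, sq_nonneg w.imJ, sq_nonneg w.imK]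
    have hK : w.imK = 0 := by nlinarith [sq_nonneg w.imI, sq_nonneg w.imJ, sq_nonneg w.imK]
    have hs : ∀ m, slicePart w (frame w m) = 0 := by
      intro m
      refine slicePart_eq (Submodule.zero_mem _) ?_ ?_
      · rw [sub_zero, frame, inner_smul_left, Quaternion.inner_def]
        fin_cases m <;> simp [hI, hJ, hK]
      · rw [sub_zero, real_inner_comm]
        exact (orthonormal_frame w h0).2 m
    rw [det_g_frame h0 0 (fun m k => by simp [hs])]
    have h2 : ‖1 - w ^ 2‖ ^ 2 = (1 - ‖w‖ ^ 2) ^ 2 := by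
      rw [norm_one_sub_sq]; nlinarith
    rw [h2]
    simp only [Pi.zero_apply]
    rw [show (((1 - ‖w‖ ^ 2) ^ 2)⁻¹ ^ 2 * (((1 - ‖w‖ ^ 2) ^ 2)⁻¹ + (((1 - ‖w‖ ^ 2) ^ 2)⁻¹ -
      ((1 - ‖w‖ ^ 2) ^ 2)⁻¹) * (0 ^ 2 + 0 ^ 2 + 0 ^ 2))) =
        (((1 - ‖w‖ ^ 2) * (1 - ‖w‖ ^ 2) ^ 2)⁻¹) ^ 2 by field_simp; ring]
    exact Real.sqrt_sq (by positivity)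
  · have hpos : 0 < w.imI ^ 2 + w.imJ ^ 2 + w.imK ^ 2 := lt_of_le_of_ne (by positivity) (Ne.symm him)
    obtain ⟨ρ, hρ, hρ2⟩ : ∃ ρ : ℝ, 0 < ρ ∧ ρ ^ 2 = w.imI ^ 2 + w.imJ ^ 2 + w.imK ^ 2 :=
      ⟨_, Real.sqrt_pos.2 hpos, Real.sq_sqrt hpos.le⟩
    let n : Fin 3 → ℝ := ![w.imI / ρ, w.imJ / ρ, w.imK / ρ]
    -- With `I` the normalized imaginary part of `w`, `τ = w I / |w|` is the unit tangent of the
    -- circle in the slice, and the slice component of the `m`-th frame vector is `n m • τ`.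
    let τ : ℍ[ℝ] := ‖w‖⁻¹ • (w * imag (n 0) (n 1) (n 2))
    have hn1 : n 0 ^ 2 + n 1 ^ 2 + n 2 ^ 2 = 1 := by
      simp only [n, Matrix.cons_val]
      field_simp
      exact hρ2.symm
    have hτ : τ ∈ slice w := by
      -- The coefficients come from `w · Im w = (Re w) w - |w|²`.
      refine Submodule.mem_span_pair.2 ⟨-(‖w‖⁻¹ * (‖w‖ ^ 2 / ρ)), ‖w‖⁻¹ * (w.re / ρ), ?_⟩
      simp only [τ, n, mul_smul, ← smul_add, ← mul_neg]
      rw [hnw]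
      congr 1
      ext <;> simp <;> field_simp <;> ring
    have hτn : inner ℝ τ τ = 1 := by
      have : ‖imag (n 0) (n 1) (n 2)‖ ^ 2 = 1 := by rw [norm_sq_eq]; simpa using hn1
      rw [real_inner_self_eq_norm_sq]
      simp only [τ]
      rw [norm_smul, norm_mul, norm_inv, norm_norm, inv_mul_cancel_left₀ hn0.ne', this]
    have hs : ∀ m, slicePart w (frame w m) = n m • τ := by
      intro m
      refine slicePart_eq (Submodule.smul_mem _ _ hτ) ?_ ?_
      · simp only [frame, τ, n, Quaternion.inner_def]
        fin_cases m <;> simp <;> field_simp <;> rw [hρ2] <;> ring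
      · rw [inner_sub_left, real_inner_comm, (orthonormal_frame w h0).2 m, inner_smul_left]
        have : inner ℝ τ w = 0 := by
          simp only [τ, inner_smul_left, Quaternion.inner_def]
          simp
          right
          ring
        rw [this]
        simp
    rw [det_g_frame h0 n fun m k => by
      rw [hs, hs, inner_smul_left, inner_smul_right, hτn]; simp, hn1]
    have h3 : 0 < ‖1 - w ^ 2‖ ^ 2 := by
      rw [norm_one_sub_sq]
      nlinarith [pow_pos hw 2]
    rw [show ((‖1 - w ^ 2‖ ^ 2)⁻¹ ^ 2 * ((‖1 - w ^ 2‖ ^ 2)⁻¹ + (((1 - ‖w‖ ^ 2) ^ 2)⁻¹ -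
      (‖1 - w ^ 2‖ ^ 2)⁻¹) * 1)) = (((1 - ‖w‖ ^ 2) * ‖1 - w ^ 2‖ ^ 2)⁻¹) ^ 2 by
        rw [mul_one, add_sub_cancel, mul_inv, mul_pow, inv_pow (1 - ‖w‖ ^ 2)]; ring]
    exact Real.sqrt_sq (by positivity)

/-! ### Polar coordinates -/

section PolarCoordinates

variable {E : Type*} [NormedAddCommGroup E] [NormedSpace ℝ E] [FiniteDimensional ℝ E]
  [MeasurableSpace E] [BorelSpace E] [Nontrivial E]

theorem lintegral_polar (μ : Measure E) [μ.IsAddHaarMeasure] {f : E → ℝ≥0∞} (hf : Measurable f) :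
    ∫⁻ x, f x ∂μ = ∫⁻ u : sphere (0 : E) 1, (∫⁻ ρ in Ioi (0 : ℝ),
      ENNReal.ofReal (ρ ^ (Module.finrank ℝ E - 1)) * f (ρ • (u : E))) ∂μ.toSphere := by
  have h1 : ∫⁻ x, f x ∂μ = ∫⁻ x : ({0}ᶜ : Set E), f x ∂(μ.comap (↑)) := by
    rw [lintegral_subtype_comap (measurableSet_singleton _).compl, restrict_compl_singleton]
  have h2 := μ.measurePreserving_homeomorphUnitSphereProd.symm
    (homeomorphUnitSphereProd E).toMeasurableEquiv
  have h3 := h2.lintegral_comp (f := fun x : ({0}ᶜ : Set E) => f x) (by fun_prop)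
  rw [h1, ← h3]
  have h4 : ∀ p : sphere (0 : E) 1 × Ioi (0 : ℝ),
      (((homeomorphUnitSphereProd E).toMeasurableEquiv.symm p : ({0}ᶜ : Set E)) : E) =
        (p.2 : ℝ) • (p.1 : E) := fun p => rfl
  simp only [h4]
  rw [lintegral_prod _ (by fun_prop)]
  congr 1
  funext u
  rw [Measure.volumeIoiPow, lintegral_withDensity_eq_lintegral_mul _ (by fun_prop) (by fun_prop),
    ← lintegral_subtype_comap measurableSet_Ioi]
  rfl

omit [Nontrivial E] in
open scoped Pointwise in
-- The sphere measure of a set is a multiple of the Haar measure of the cone over it, and Haar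
-- measure is invariant under negation.
theorem measurePreserving_neg_toSphere (μ : Measure E) [μ.IsAddHaarMeasure] :
    MeasurePreserving (fun u : sphere (0 : E) 1 => -u) μ.toSphere μ.toSphere := by
  refine ⟨measurable_neg, ?_⟩
  ext s hs
  rw [Measure.map_apply measurable_neg hs, Measure.toSphere_apply' _ hs,
    Measure.toSphere_apply' _ (measurable_neg hs)]
  congr 1
  rw [← Measure.measure_preimage_neg μ (Ioo (0 : ℝ) 1 • (Subtype.val '' s))]
  congr 1
  ext x
  simp only [mem_preimage, Set.mem_smul, mem_image]
  constructor
  · rintro ⟨ρ, hρ, -, ⟨u, hu, rfl⟩, rfl⟩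
    exact ⟨ρ, hρ, _, ⟨-u, hu, rfl⟩, by simp⟩
  · rintro ⟨ρ, hρ, -, ⟨u, hu, rfl⟩, hx⟩
    exact ⟨ρ, hρ, _, ⟨-u, by simpa using hu, rfl⟩, by simp [hx]⟩

end PolarCoordinates

/-- Quaternions as the orthogonal sum of the reals and the imaginary quaternions. -/
noncomputable def realImagEquiv : WithLp 2 (ℝ × EuclideanSpace ℝ (Fin 3)) ≃ₗᵢ[ℝ] ℍ[ℝ] where
  toFun p := (p.fst : ℍ[ℝ]) + imUnit p.snd
  invFun q := WithLp.toLp 2 (q.re, !₂[q.imI, q.imJ, q.imK])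
  map_add' p q := by ext <;> simp [imUnit]
  map_smul' c p := by ext <;> simp [imUnit]
  left_inv p := by
    refine (WithLp.ofLp_injective 2) (Prod.ext ?_ ?_)
    · simp [imUnit]
    · ext i
      fin_cases i <;> simp [imUnit]
  right_inv q := by ext <;> simp [imUnit]
  norm_map' p := by
    rw [← sq_eq_sq₀ (norm_nonneg _) (norm_nonneg _), WithLp.prod_norm_sq_eq_of_L2,
      EuclideanSpace.norm_sq_eq, Fin.sum_univ_three]
    change ‖(p.fst : ℍ[ℝ]) + imUnit p.snd‖ ^ 2 = _
    rw [norm_sq_eq]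
    simp [imUnit]
    ring

theorem measurePreserving_real_add_imUnit :
    MeasurePreserving (fun p : ℝ × EuclideanSpace ℝ (Fin 3) => (p.1 : ℍ[ℝ]) + imUnit p.2)
      (volume.prod volume) volume :=
  realImagEquiv.measurePreserving.comp (WithLp.volume_preserving_toLp ℝ (EuclideanSpace ℝ (Fin 3)))

/-- The point `e^{tI}` of the three-sphere. -/
noncomputable def polarPoint (t : ℝ) (I : sphere (0 : EuclideanSpace ℝ (Fin 3)) 1) : ℍ[ℝ] :=
  ((Real.cos t : ℝ) : ℍ[ℝ]) + Real.sin t • imUnit I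

theorem continuous_imUnit : Continuous imUnit := by
  have : imUnit = fun v => realImagEquiv (WithLp.toLp 2 ((0 : ℝ), v)) := by
    funext v
    ext <;> simp [realImagEquiv, imUnit]
  rw [this]
  exact realImagEquiv.continuous.comp (by fun_prop)

theorem continuous_polarPoint : Continuous fun p : ℝ × sphere (0 : EuclideanSpace ℝ (Fin 3)) 1 =>
    polarPoint p.1 p.2 := by
  unfold polarPoint
  have h1 : Continuous fun p : ℝ × sphere (0 : EuclideanSpace ℝ (Fin 3)) 1 =>
      imUnit (p.2 : EuclideanSpace ℝ (Fin 3)) := continuous_imUnit.comp (by fun_prop)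
  have h2 : Continuous fun p : ℝ × sphere (0 : EuclideanSpace ℝ (Fin 3)) 1 =>
      ((Real.cos p.1 : ℝ) : ℍ[ℝ]) := Quaternion.continuous_coe.comp (by fun_prop)
  fun_prop

theorem continuous_polarPoint_left (I : sphere (0 : EuclideanSpace ℝ (Fin 3)) 1) :
    Continuous fun t => polarPoint t I := by
  unfold polarPoint
  have h2 : Continuous fun t : ℝ => ((Real.cos t : ℝ) : ℍ[ℝ]) :=
    Quaternion.continuous_coe.comp (by fun_prop)
  fun_prop

theorem re_polarPoint (t : ℝ) (I : sphere (0 : EuclideanSpace ℝ (Fin 3)) 1) :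
    (polarPoint t I).re = Real.cos t := by
  simp [polarPoint, imUnit]

theorem norm_imUnit (v : EuclideanSpace ℝ (Fin 3)) : ‖imUnit v‖ = ‖v‖ := by
  rw [← sq_eq_sq₀ (norm_nonneg _) (norm_nonneg _), norm_sq_eq, EuclideanSpace.norm_sq_eq,
    Fin.sum_univ_three]
  simp [imUnit]

theorem norm_polarPoint (t : ℝ) (I : sphere (0 : EuclideanSpace ℝ (Fin 3)) 1) :
    ‖polarPoint t I‖ = 1 := by
  have hI : ‖imUnit I‖ ^ 2 = 1 := by rw [norm_imUnit]; simp
  rw [norm_sq_eq] at hI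
  rw [← sq_eq_sq₀ (norm_nonneg _) zero_le_one, norm_sq_eq]
  simp only [imUnit, imag_re, imag_imI, imag_imJ, imag_imK] at hI
  simp [polarPoint, imUnit]
  nlinarith [Real.sin_sq_add_cos_sq t]

/-- To be applied to the pair of the real part and the length of the imaginary part of a quaternion;
the second is positive, so the angle ranges over `(0, π)`. -/
theorem lintegral_half_plane {f : ℝ × ℝ → ℝ≥0∞} (hf : Measurable f) :
    ∫⁻ x : ℝ, ∫⁻ y in Ioi (0 : ℝ), f (x, y) =
      ∫⁻ R in Ioi (0 : ℝ), ∫⁻ t in Ioo 0 Real.pi,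
        ENNReal.ofReal R * f (R * Real.cos t, R * Real.sin t) := by
  have h1 : ∫⁻ x : ℝ, ∫⁻ y in Ioi (0 : ℝ), f (x, y) =
      ∫⁻ p : ℝ × ℝ, (univ ×ˢ Ioi (0 : ℝ)).indicator f p := by
    rw [lintegral_indicator (MeasurableSet.univ.prod measurableSet_Ioi), Measure.volume_eq_prod,
      ← Measure.prod_restrict, Measure.restrict_univ, lintegral_prod _ hf.aemeasurable]
  rw [h1, ← lintegral_comp_polarCoord_symm, polarCoord_target, Measure.volume_eq_prod,
    ← Measure.prod_restrict, lintegral_prod]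
  · refine setLIntegral_congr_fun measurableSet_Ioi fun R hR => ?_
    rw [← lintegral_indicator measurableSet_Ioo, ← lintegral_indicator measurableSet_Ioo]
    congr 1
    funext t
    simp only [polarCoord_symm_apply, smul_eq_mul]
    by_cases ht : t ∈ Ioo 0 Real.pi
    · have hs : (R * Real.cos t, R * Real.sin t) ∈ (univ ×ˢ Ioi (0 : ℝ) : Set (ℝ × ℝ)) :=
        ⟨trivial, mul_pos hR (Real.sin_pos_of_pos_of_lt_pi ht.1 ht.2)⟩
      rw [indicator_of_mem ht, indicator_of_mem (show t ∈ Ioo (-Real.pi) Real.pi from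
        ⟨by linarith [ht.1, Real.pi_pos], ht.2⟩),
        indicator_of_mem hs]
    · rw [indicator_of_notMem ht]
      by_cases ht' : t ∈ Ioo (-Real.pi) Real.pi
      · have ht0 : t ≤ 0 := by
          by_contra h
          exact ht ⟨not_le.1 h, ht'.2⟩
        have hs : (R * Real.cos t, R * Real.sin t) ∉ (univ ×ˢ Ioi (0 : ℝ) : Set (ℝ × ℝ)) := by
          rintro ⟨-, h⟩
          have := Real.sin_nonpos_of_nonpos_of_neg_pi_le ht0 ht'.1.le
          exact absurd h (not_lt.2 (mul_nonpos_of_nonneg_of_nonpos (le_of_lt hR) this))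
        rw [indicator_of_mem ht', indicator_of_notMem hs, mul_zero]
      · rw [indicator_of_notMem ht']
  · refine Measurable.aemeasurable ?_
    have := hf.indicator (MeasurableSet.univ.prod (measurableSet_Ioi (a := (0 : ℝ))))
    exact (ENNReal.measurable_ofReal.comp measurable_fst).smul
      (this.comp continuous_polarCoord_symm.measurable)

theorem smul_polarPoint (R t : ℝ) (I : sphere (0 : EuclideanSpace ℝ (Fin 3)) 1) :
    R • polarPoint t I = ((R * Real.cos t : ℝ) : ℍ[ℝ]) +
      imUnit ((R * Real.sin t) • (I : EuclideanSpace ℝ (Fin 3))) := by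
  ext <;> simp [polarPoint, imUnit] <;> ring

/-- The angular measure `dt dA(I)` on `[0, π] × 𝕊`. -/
noncomputable def angularMeasure : Measure (ℝ × sphere (0 : EuclideanSpace ℝ (Fin 3)) 1) :=
  ((volume : Measure ℝ).restrict (Icc 0 Real.pi)).prod
    (volume : Measure (EuclideanSpace ℝ (Fin 3))).toSphere

instance : IsFiniteMeasure angularMeasure := by
  unfold angularMeasure; infer_instance

theorem lintegral_Ioi_cube_mul_indicator :
    ∫⁻ ρ in Ioi (0 : ℝ), ENNReal.ofReal (ρ ^ 3) * (Ioo (0 : ℝ) 1).indicator 1 ρ =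
      ENNReal.ofReal (1 / 4) := by
  have h1 : ∀ ρ : ℝ, ENNReal.ofReal (ρ ^ 3) * (Ioo (0 : ℝ) 1).indicator (1 : ℝ → ℝ≥0∞) ρ =
      (Ioo (0 : ℝ) 1).indicator (fun ρ => ENNReal.ofReal (ρ ^ 3)) ρ := fun ρ => by
    by_cases h : ρ ∈ Ioo (0 : ℝ) 1 <;> simp [h]
  simp only [h1]
  rw [lintegral_indicator measurableSet_Ioo, Measure.restrict_restrict measurableSet_Ioo,
    inter_eq_self_of_subset_left Ioo_subset_Ioi_self,
    Measure.restrict_congr_set (Ioo_ae_eq_Ioc (μ := volume)), ← ofReal_integral_eq_lintegral_ofReal,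
    ← intervalIntegral.integral_of_le zero_le_one, integral_pow]
  · norm_num
  · exact (intervalIntegral.intervalIntegrable_pow 3).1
  · filter_upwards [ae_restrict_mem measurableSet_Ioc] with ρ hρ
    exact pow_nonneg hρ.1.le _

/-- Polar coordinates `R e^{tI}` on the quaternions. -/
theorem lintegral_quaternion_polar {F : ℍ[ℝ] → ℝ≥0∞} (hF : Measurable F) :
    ∫⁻ q, F q = ∫⁻ I : sphere (0 : EuclideanSpace ℝ (Fin 3)) 1, (∫⁻ R in Ioi (0 : ℝ),
      ∫⁻ t in Icc 0 Real.pi, ENNReal.ofReal (R ^ 3) * (ENNReal.ofReal (Real.sin t ^ 2) *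
        F (R • polarPoint t I))) ∂(volume : Measure (EuclideanSpace ℝ (Fin 3))).toSphere := by
  have himm : Measurable imUnit := continuous_imUnit.measurable
  have hcoem : Measurable fun x : ℝ => (x : ℍ[ℝ]) := Quaternion.continuous_coe.measurable
  rw [← measurePreserving_real_add_imUnit.lintegral_comp hF, lintegral_prod _ (by fun_prop)]
  -- The imaginary part is written as `s I` in polar coordinates of `ℝ³`, then `(x, s) = (R cos t, R
  -- sin t)`. The Jacobians `s²` and `R` combine to `R³ sin² t`.
  have h1 : ∀ x : ℝ, ∫⁻ v, F ((x : ℍ[ℝ]) + imUnit v) =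
      ∫⁻ I : sphere (0 : EuclideanSpace ℝ (Fin 3)) 1, (∫⁻ s in Ioi (0 : ℝ),
        ENNReal.ofReal (s ^ 2) * F ((x : ℍ[ℝ]) + imUnit (s • (I : EuclideanSpace ℝ (Fin 3)))))
          ∂(volume : Measure (EuclideanSpace ℝ (Fin 3))).toSphere := fun x => by
    rw [lintegral_polar volume (f := fun v => F ((x : ℍ[ℝ]) + imUnit v)) (by fun_prop)]
    simp
  simp only [h1]
  have hm : Measurable fun q : (ℝ × sphere (0 : EuclideanSpace ℝ (Fin 3)) 1) × ℝ =>
      ENNReal.ofReal (q.2 ^ 2) *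
        F ((q.1.1 : ℍ[ℝ]) + imUnit (q.2 • (q.1.2 : EuclideanSpace ℝ (Fin 3)))) := by
    fun_prop
  rw [lintegral_lintegral_swap (hm.lintegral_prod_right'
    (ν := (volume : Measure ℝ).restrict (Ioi (0 : ℝ)))).aemeasurable]
  congr 1
  funext I
  rw [lintegral_half_plane (f := fun p => ENNReal.ofReal (p.2 ^ 2) *
    F ((p.1 : ℍ[ℝ]) + imUnit (p.2 • (I : EuclideanSpace ℝ (Fin 3))))) (by fun_prop)]
  refine setLIntegral_congr_fun measurableSet_Ioi fun R hR => ?_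
  simp only
  rw [Measure.restrict_congr_set (Ioo_ae_eq_Icc (μ := volume))]
  congr 1
  funext t
  rw [← smul_polarPoint, mul_pow, ENNReal.ofReal_mul (sq_nonneg R), show R ^ 3 = R * R ^ 2 by ring,
    ENNReal.ofReal_mul (le_of_lt hR)]
  ring

/-- The Euclidean surface measure of the three-sphere in polar coordinates. -/
theorem lintegral_sphereArea_one {f : ℍ[ℝ] → ℝ≥0∞} (hf : Measurable f) :
    ∫⁻ q, f q ∂(sphereArea 1) =
      ∫⁻ p, ENNReal.ofReal (Real.sin p.1 ^ 2) * f (polarPoint p.1 p.2) ∂angularMeasure := by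
  have hφm : Measurable ((Ioo (0 : ℝ) 1).indicator (1 : ℝ → ℝ≥0∞)) :=
    measurable_one.indicator measurableSet_Ioo
  have hc := lintegral_Ioi_cube_mul_indicator
  obtain ⟨φ, hφ⟩ : ∃ φ : ℝ → ℝ≥0∞, φ = (Ioo (0 : ℝ) 1).indicator 1 := ⟨_, rfl⟩
  rw [← hφ] at hφm hc
  -- The radial extension of `f`, cut off to the unit ball, is integrated over `ℍ` in both systems
  -- of polar coordinates. The common radial factor `∫₀¹ ρ³ = 1/4` is cancelled at the end.
  obtain ⟨F, hF⟩ : ∃ F : ℍ[ℝ] → ℝ≥0∞, F = fun q => φ ‖q‖ * f (‖q‖⁻¹ • q) := ⟨_, rfl⟩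
  have hFm : Measurable F := by rw [hF]; fun_prop
  have hFs : ∀ (R : ℝ) (q : ℍ[ℝ]), 0 < R → ‖q‖ = 1 → F (R • q) = φ R * f q := by
    intro R q hR hq
    rw [hF]
    simp only
    rw [norm_smul, hq, mul_one, Real.norm_eq_abs, abs_of_pos hR, smul_smul, inv_mul_cancel₀ hR.ne',
      one_smul]
  have hpp : Measurable fun p : ℝ × sphere (0 : EuclideanSpace ℝ (Fin 3)) 1 =>
    polarPoint p.1 p.2 := continuous_polarPoint.measurable
  have hcm : Measurable fun ρ => ENNReal.ofReal (ρ ^ 3) * φ ρ := by fun_prop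
  have hL : ∫⁻ q, F q = ENNReal.ofReal (1 / 4) * ∫⁻ q, f q ∂(sphereArea 1) := by
    have h1 : ∫⁻ q, f q ∂(sphereArea 1) =
        ∫⁻ u : sphere (0 : ℍ[ℝ]) 1, f u ∂(volume : Measure ℍ[ℝ]).toSphere := by
      rw [sphereArea, one_pow, ENNReal.ofReal_one, one_smul, lintegral_map hf (by fun_prop)]
      simp
    rw [h1, lintegral_polar volume hFm, ← lintegral_const_mul _ (by fun_prop),
      Quaternion.finrank_eq_four]
    congr 1
    funext u
    rw [← hc, ← lintegral_mul_const _ hcm]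
    refine setLIntegral_congr_fun measurableSet_Ioi fun ρ hρ => ?_
    rw [hFs ρ u hρ (by simp), mul_assoc]
  have hm2 : Measurable fun p : ℝ × sphere (0 : EuclideanSpace ℝ (Fin 3)) 1 =>
      ENNReal.ofReal (Real.sin p.1 ^ 2) * f (polarPoint p.1 p.2) := by fun_prop
  have hR : ∫⁻ q, F q = ENNReal.ofReal (1 / 4) * ∫⁻ p, ENNReal.ofReal (Real.sin p.1 ^ 2) *
      f (polarPoint p.1 p.2) ∂angularMeasure := by
    rw [lintegral_quaternion_polar hFm, angularMeasure, lintegral_prod_symm _ hm2.aemeasurable,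
      ← lintegral_const_mul _ hm2.lintegral_prod_left']
    congr 1
    funext I
    rw [← hc, ← lintegral_mul_const _ hcm]
    refine setLIntegral_congr_fun measurableSet_Ioi fun R hR => ?_
    simp only
    have hmI : Measurable fun t => ENNReal.ofReal (Real.sin t ^ 2) * f (polarPoint t I) :=
      (Measurable.ennreal_ofReal (by fun_prop)).mul (hf.comp (continuous_polarPoint_left I).measurable)
    rw [← lintegral_const_mul _ hmI]
    congr 1
    funext t
    rw [hFs R _ hR (norm_polarPoint t I)]
    ring
  rw [hL] at hR
  exact (ENNReal.mul_right_inj (by simp) (by simp)).1 hR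

/-! ### Slice decomposition of power series -/

theorem toSphere_univ_fin_three :
    (volume : Measure (EuclideanSpace ℝ (Fin 3))).toSphere univ = ENNReal.ofReal (4 * Real.pi) := by
  rw [Measure.toSphere_apply_univ, EuclideanSpace.volume_ball_fin_three, finrank_euclideanSpace_fin,
    ← ENNReal.ofReal_natCast, ← ENNReal.ofReal_pow zero_le_one, ← ENNReal.ofReal_mul (by positivity),
    ← ENNReal.ofReal_mul (by positivity)]
  congr 1
  push_cast
  ring

/-- Averaging over `I` and `-I` and applying the parallelogram law, with `|I V| = |V|`, turns the
integrand into a constant; the sphere has area `4π`. -/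
theorem lintegral_norm_sq_add_imUnit_mul (U V : ℍ[ℝ]) :
    ∫⁻ I : sphere (0 : EuclideanSpace ℝ (Fin 3)) 1, ENNReal.ofReal (‖U + imUnit I * V‖ ^ 2)
      ∂(volume : Measure (EuclideanSpace ℝ (Fin 3))).toSphere =
        ENNReal.ofReal (4 * Real.pi * (‖U‖ ^ 2 + ‖V‖ ^ 2)) := by
  have himm : Measurable imUnit := continuous_imUnit.measurable
  have hm : Measurable fun I : sphere (0 : EuclideanSpace ℝ (Fin 3)) 1 =>
    ENNReal.ofReal (‖U + imUnit I * V‖ ^ 2) := by fun_prop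
  have h1 := (measurePreserving_neg_toSphere (volume : Measure (EuclideanSpace ℝ (Fin 3)))).lintegral_comp hm
  have hneg : ∀ v : EuclideanSpace ℝ (Fin 3), imUnit (-v) = -imUnit v := fun v => by
    ext <;> simp [imUnit]
  simp only [coe_neg_sphere, hneg] at h1
  have h2 : ∀ I : sphere (0 : EuclideanSpace ℝ (Fin 3)) 1,
      ENNReal.ofReal (‖U + -imUnit I * V‖ ^ 2) + ENNReal.ofReal (‖U + imUnit I * V‖ ^ 2) =
        ENNReal.ofReal (2 * (‖U‖ ^ 2 + ‖V‖ ^ 2)) := fun I => by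
    have hI : ‖imUnit I‖ = 1 := by rw [norm_imUnit]; simp
    rw [← ENNReal.ofReal_add (by positivity) (by positivity)]
    congr 1
    have := parallelogram_law_with_norm ℝ U (imUnit I * V)
    rw [norm_mul, hI, one_mul] at this
    rw [neg_mul, ← sub_eq_add_neg]
    nlinarith
  have h3 : ∀ J : ℝ≥0∞, J + J = 2 * J := fun J => (two_mul J).symm
  rw [← ENNReal.mul_right_inj (a := 2) (by simp) (by simp), ← h3]
  nth_rewrite 1 [← h1]
  rw [← lintegral_add_right _ hm]
  simp only [h2]
  rw [lintegral_const, toSphere_univ_fin_three, ← ENNReal.ofReal_mul (by positivity),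
    show (2 : ℝ≥0∞) = ENNReal.ofReal 2 by simp, ← ENNReal.ofReal_mul (by positivity)]
  congr 1
  ring

/-- An orthonormal basis of the quaternions. -/
noncomputable def quatBasis : OrthonormalBasis (Fin (Module.finrank ℝ ℍ[ℝ])) ℝ ℍ[ℝ] :=
  stdOrthonormalBasis ℝ ℍ[ℝ]

/-- The quaternion `U + I V`, where `U + iV` has the complex coordinates `z`. -/
noncomputable def combine (z : Fin (Module.finrank ℝ ℍ[ℝ]) → ℂ)
    (I : sphere (0 : EuclideanSpace ℝ (Fin 3)) 1) : ℍ[ℝ] :=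
  (∑ j, (z j).re • quatBasis j) + imUnit I * ∑ j, (z j).im • quatBasis j

theorem continuous_combine : Continuous fun p : (Fin (Module.finrank ℝ ℍ[ℝ]) → ℂ) ×
    sphere (0 : EuclideanSpace ℝ (Fin 3)) 1 => combine p.1 p.2 := by
  unfold combine
  have := continuous_imUnit
  fun_prop

theorem norm_sq_sum_smul_quatBasis (x : Fin (Module.finrank ℝ ℍ[ℝ]) → ℝ) :
    ‖∑ j, x j • quatBasis j‖ ^ 2 = ∑ j, x j ^ 2 := by
  rw [← quatBasis.sum_sq_norm_inner_right]
  congr 1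
  funext j
  rw [quatBasis.orthonormal.inner_right_fintype, Real.norm_eq_abs, sq_abs]

theorem lintegral_norm_sq_combine (z : Fin (Module.finrank ℝ ℍ[ℝ]) → ℂ) :
    ∫⁻ I, ENNReal.ofReal (‖combine z I‖ ^ 2)
      ∂(volume : Measure (EuclideanSpace ℝ (Fin 3))).toSphere =
        ENNReal.ofReal (4 * Real.pi * ∑ j, ‖z j‖ ^ 2) := by
  simp only [combine]
  rw [lintegral_norm_sq_add_imUnit_mul, norm_sq_sum_smul_quatBasis, norm_sq_sum_smul_quatBasis,
    ← Finset.sum_add_distrib]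
  congr 3
  funext j
  rw [Complex.sq_norm, Complex.normSq_apply]
  ring

/-- Integration of `|U + I V|²` with a weight that depends on the angle only. -/
theorem lintegral_angularMeasure_combine {w : ℝ → ℝ≥0∞} (hw : Measurable w)
    {z : ℝ → Fin (Module.finrank ℝ ℍ[ℝ]) → ℂ}
    (hz : AEMeasurable z (volume.restrict (Icc 0 Real.pi))) :
    ∫⁻ p, w p.1 * ENNReal.ofReal (‖combine (z p.1) p.2‖ ^ 2) ∂angularMeasure =
      ∫⁻ t in Icc 0 Real.pi, w t * ENNReal.ofReal (4 * Real.pi * ∑ j, ‖z t j‖ ^ 2) := by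
  have hc : ∀ x, Measurable fun I => ENNReal.ofReal (‖combine x I‖ ^ 2) := fun x =>
    (((continuous_combine.comp (Continuous.prodMk_right x)).norm.pow 2).measurable).ennreal_ofReal
  rw [angularMeasure, lintegral_prod]
  · congr 1
    funext t
    simp only
    rw [lintegral_const_mul _ (hc _), lintegral_norm_sq_combine]
  · have h1 : AEMeasurable
        (fun p : ℝ × sphere (0 : EuclideanSpace ℝ (Fin 3)) 1 => (z p.1, p.2))
        ((volume.restrict (Icc 0 Real.pi)).prod
          (volume : Measure (EuclideanSpace ℝ (Fin 3))).toSphere) :=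
      AEMeasurable.prodMk (AEMeasurable.comp_fst hz) measurable_snd.aemeasurable
    have h2 : Measurable fun p : (Fin (Module.finrank ℝ ℍ[ℝ]) → ℂ) ×
        sphere (0 : EuclideanSpace ℝ (Fin 3)) 1 => ENNReal.ofReal (‖combine p.1 p.2‖ ^ 2) :=
      (continuous_combine.norm.pow 2).measurable.ennreal_ofReal
    have h3 := h2.comp_aemeasurable h1
    exact (hw.comp measurable_fst).aemeasurable.mul h3

/-- The addition theorems for sine and cosine, together with `I² = -1`. -/
theorem polarPoint_mul (s t : ℝ) (I : sphere (0 : EuclideanSpace ℝ (Fin 3)) 1) :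
    polarPoint s I * polarPoint t I = polarPoint (s + t) I := by
  have hI : ‖imUnit I‖ ^ 2 = 1 := by rw [norm_imUnit]; simp
  rw [norm_sq_eq] at hI
  simp only [imUnit, imag_re, imag_imI, imag_imJ, imag_imK] at hI
  ext
  · simp [polarPoint, imUnit, Real.cos_add]
    linear_combination -(Real.sin s * Real.sin t) * hI
  all_goals
    simp [polarPoint, imUnit, Real.sin_add]
    ring

theorem polarPoint_pow (t : ℝ) (I : sphere (0 : EuclideanSpace ℝ (Fin 3)) 1) (n : ℕ) :
    polarPoint t I ^ n = polarPoint (n * t) I := by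
  induction n with
  | zero => ext <;> simp [polarPoint]
  | succ n ih => rw [pow_succ, ih, polarPoint_mul]; push_cast; ring_nf

/-- The coordinates of a quaternionic sequence. -/
noncomputable def coord (a : ℕ → ℍ[ℝ]) (j : Fin (Module.finrank ℝ ℍ[ℝ])) (n : ℕ) : ℝ :=
  inner ℝ (quatBasis j) (a n)

theorem sum_coord_sq (a : ℕ → ℍ[ℝ]) (n : ℕ) : ∑ j, coord a j n ^ 2 = ‖a n‖ ^ 2 := by
  rw [← quatBasis.sum_sq_norm_inner_right]
  simp [coord]

theorem summable_coord_sq {a : ℕ → ℍ[ℝ]} (ha : MemHardy a) (j : Fin (Module.finrank ℝ ℍ[ℝ])) :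
    Summable fun n => coord a j n ^ 2 := by
  refine Summable.of_nonneg_of_le (fun n => sq_nonneg _) (fun n => ?_) ha
  rw [← sum_coord_sq]
  exact Finset.single_le_sum (f := fun j => coord a j n ^ 2) (fun i _ => sq_nonneg _)
    (Finset.mem_univ j)

theorem sum_tsum_coord_sq {a : ℕ → ℍ[ℝ]} (ha : MemHardy a) :
    ∑ j, ∑' n, coord a j n ^ 2 = ∑' n, ‖a n‖ ^ 2 := by
  rw [← Summable.tsum_finsetSum fun j _ => summable_coord_sq ha j]
  simp only [sum_coord_sq]

/-- The complex coordinates of the power series on the slices. -/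
noncomputable def sliceSeries (a : ℕ → ℍ[ℝ]) (r t : ℝ) (j : Fin (Module.finrank ℝ ℍ[ℝ])) : ℂ :=
  powerSum (fun n => (coord a j n : ℂ)) (r * Complex.exp (t * Complex.I))

theorem summable_norm_coord_sq {a : ℕ → ℍ[ℝ]} (ha : MemHardy a)
    (j : Fin (Module.finrank ℝ ℍ[ℝ])) : Summable fun n => ‖(coord a j n : ℂ)‖ ^ 2 := by
  simpa [Complex.norm_real] using summable_coord_sq ha j

/-- By de Moivre each term is `rⁿ (cos nt + I sin nt) a n`. The coordinates of `a n` are real and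
commute with `I`, so the real and imaginary parts of the four coordinate series can be summed
separately, with `I` multiplied on the left. -/
theorem hasSum_eval_polarPoint {a : ℕ → ℍ[ℝ]} (ha : MemHardy a) {r : ℝ} (hr : r ∈ Ioo (0 : ℝ) 1)
    (t : ℝ) (I : sphere (0 : EuclideanSpace ℝ (Fin 3)) 1) :
    HasSum (fun n => (r • polarPoint t I) ^ n * a n) (combine (sliceSeries a r t) I) := by
  have hz : ‖(r : ℂ) * Complex.exp (t * Complex.I)‖ < 1 := by
    rw [norm_mul, Complex.norm_exp_ofReal_mul_I, mul_one, Complex.norm_real, Real.norm_eq_abs,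
      abs_of_pos hr.1]
    exact hr.2
  have hj : ∀ j, HasSum (fun n => (coord a j n : ℂ) * (r * Complex.exp (t * Complex.I)) ^ n)
      (sliceSeries a r t j) := fun j =>
    (summable_mul_pow_of_summable_sq (summable_norm_coord_sq ha j) hz).of_norm.hasSum
  have hterm : ∀ j n, (coord a j n : ℂ) * (r * Complex.exp (t * Complex.I)) ^ n =
      ((coord a j n * r ^ n * Real.cos (n * t) : ℝ) : ℂ) +
        ((coord a j n * r ^ n * Real.sin (n * t) : ℝ) : ℂ) * Complex.I := fun j n => by
    rw [mul_pow, ← Complex.exp_nat_mul, ← mul_assoc (n : ℂ), Complex.exp_mul_I]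
    push_cast
    ring
  have hre := hasSum_sum (s := Finset.univ) fun j _ =>
    (Complex.hasSum_re (hj j)).smul_const (quatBasis j)
  have him := hasSum_sum (s := Finset.univ) fun j _ =>
    (Complex.hasSum_im (hj j)).smul_const (quatBasis j)
  have hsum := hre.add (him.mul_left (imUnit I))
  rw [combine]
  refine hsum.congr fun s => ?_
  refine Finset.sum_congr rfl fun n _ => ?_
  have ha : a n = ∑ j, coord a j n • quatBasis j := (quatBasis.sum_repr' (a n)).symm
  have h1 : ∑ j, ((coord a j n : ℂ) * (r * Complex.exp (t * Complex.I)) ^ n).re • quatBasis j =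
      (r ^ n * Real.cos (n * t)) • a n := by
    rw [ha, Finset.smul_sum]
    refine Finset.sum_congr rfl fun j _ => ?_
    rw [hterm, smul_smul, Complex.add_re, Complex.ofReal_re, Complex.re_ofReal_mul, Complex.I_re]
    congr 1
    ring
  have h2 : ∑ j, ((coord a j n : ℂ) * (r * Complex.exp (t * Complex.I)) ^ n).im • quatBasis j =
      (r ^ n * Real.sin (n * t)) • a n := by
    rw [ha, Finset.smul_sum]
    refine Finset.sum_congr rfl fun j _ => ?_
    rw [hterm, smul_smul, Complex.add_im, Complex.ofReal_im, Complex.im_ofReal_mul, Complex.I_im]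
    congr 1
    ring
  simp only
  rw [h1, h2, smul_pow, polarPoint_pow, polarPoint, smul_mul_assoc, add_mul, smul_add,
    Quaternion.coe_mul_eq_smul, smul_smul, smul_mul_assoc, smul_smul, mul_smul_comm]

/-! ### The angular kernel and the limit of the weighted integrals -/

/-- `(1 - r²)` times the density of the volume of `r 𝕊³` in the angular coordinates. -/
noncomputable def angularKernel (r t : ℝ) : ℝ :=
  r ^ 3 * Real.sin t ^ 2 / ((1 - r ^ 2) ^ 2 + 4 * (r ^ 2 * Real.sin t ^ 2))

theorem angularKernel_denom_pos {r : ℝ} (hr : r ∈ Ioo (0 : ℝ) 1) (t : ℝ) :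
    0 < (1 - r ^ 2) ^ 2 + 4 * (r ^ 2 * Real.sin t ^ 2) := by
  have : 0 < 1 - r ^ 2 := by nlinarith [hr.1, hr.2]
  positivity

theorem angularKernel_nonneg {r : ℝ} (hr : r ∈ Ioo (0 : ℝ) 1) (t : ℝ) : 0 ≤ angularKernel r t := by
  have := angularKernel_denom_pos hr t
  have := hr.1
  unfold angularKernel
  positivity

/-- Drop `(1 - r²)²` from the denominator and use `r³ ≤ r²`. The bound equals the limit for `r → 1`,
which makes the upper estimate of the weighted integrals sharp. -/
theorem angularKernel_le {r : ℝ} (hr : r ∈ Ioo (0 : ℝ) 1) (t : ℝ) : angularKernel r t ≤ 1 / 4 := by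
  rw [angularKernel, div_le_iff₀ (angularKernel_denom_pos hr t)]
  have h1 : r ^ 3 ≤ r ^ 2 := pow_le_pow_of_le_one hr.1.le hr.2.le (by norm_num)
  nlinarith [mul_le_mul_of_nonneg_right h1 (sq_nonneg (Real.sin t)), sq_nonneg (1 - r ^ 2)]

theorem continuous_angularKernel {r : ℝ} (hr : r ∈ Ioo (0 : ℝ) 1) : Continuous (angularKernel r) := by
  unfold angularKernel
  exact Continuous.div (by fun_prop) (by fun_prop) fun t => (angularKernel_denom_pos hr t).ne'

theorem tendsto_angularKernel {t : ℝ} (ht : Real.sin t ≠ 0) :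
    Tendsto (fun r => angularKernel r t) (𝓝[<] 1) (𝓝 (1 / 4)) := by
  have h : ContinuousAt (fun r => angularKernel r t) 1 := by
    unfold angularKernel
    refine ContinuousAt.div (by fun_prop) (by fun_prop) ?_
    simpa using ht
  have h1 : angularKernel 1 t = 1 / 4 := by
    rw [angularKernel]
    field_simp
    ring
  rw [← h1]
  exact h.tendsto.mono_left nhdsWithin_le_nhds

theorem ae_sin_pos : ∀ᵐ t ∂(volume.restrict (Icc 0 Real.pi)), 0 < Real.sin t := by
  rw [Measure.restrict_congr_set (Ioo_ae_eq_Icc (μ := volume)).symm]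
  filter_upwards [ae_restrict_mem measurableSet_Ioo] with t ht
  exact Real.sin_pos_of_pos_of_lt_pi ht.1 ht.2

theorem continuous_sliceSeries {a : ℕ → ℍ[ℝ]} (ha : MemHardy a) {r : ℝ} (hr : r ∈ Ioo (0 : ℝ) 1) :
    Continuous (sliceSeries a r) :=
  continuous_pi fun j => continuous_powerSum_circle (summable_norm_coord_sq ha j) hr

theorem lintegral_sum_norm_sq {z : ℝ → Fin (Module.finrank ℝ ℍ[ℝ]) → ℂ}
    (hz : AEMeasurable z (volume.restrict (Icc 0 Real.pi))) {C : ℝ} (hC : 0 ≤ C) :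
    ∫⁻ t in Icc 0 Real.pi, ENNReal.ofReal (C * ∑ j, ‖z t j‖ ^ 2) =
      ENNReal.ofReal C * ∑ j, ∫⁻ t in Icc 0 Real.pi, ENNReal.ofReal (‖z t j‖ ^ 2) := by
  have hzj : ∀ j, AEMeasurable (fun t => ENNReal.ofReal (‖z t j‖ ^ 2))
      (volume.restrict (Icc 0 Real.pi)) := fun j => by
    have := (measurable_pi_apply j).comp_aemeasurable hz
    exact (this.norm.pow_const 2).ennreal_ofReal
  rw [← lintegral_finsetSum' _ fun j _ => hzj j, ← lintegral_const_mul'' _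
    (Finset.aemeasurable_fun_sum _ fun j _ => hzj j)]
  congr 1
  funext t
  rw [ENNReal.ofReal_mul hC, ENNReal.ofReal_sum_of_nonneg fun j _ => by positivity]

theorem sum_ofReal_coord {a : ℕ → ℍ[ℝ]} (ha : MemHardy a) {C : ℝ} (hC : 0 ≤ C) :
    ENNReal.ofReal C * ∑ j, ENNReal.ofReal (Real.pi * ∑' n, coord a j n ^ 2) =
      ENNReal.ofReal (C * Real.pi * ∑' n, ‖a n‖ ^ 2) := by
  have hp : ∀ j, 0 ≤ ∑' n, coord a j n ^ 2 := fun j => tsum_nonneg fun n => sq_nonneg _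
  rw [← ENNReal.ofReal_sum_of_nonneg fun j _ => mul_nonneg Real.pi_pos.le (hp j),
    ← ENNReal.ofReal_mul hC, ← Finset.mul_sum, sum_tsum_coord_sq ha, mul_assoc]

/-- The boundary functions of the complex coordinates of a power series. -/
theorem exists_boundarySeries {a : ℕ → ℍ[ℝ]} (ha : MemHardy a) :
    ∃ F : ℝ → Fin (Module.finrank ℝ ℍ[ℝ]) → ℂ, AEMeasurable F (volume.restrict (Icc 0 Real.pi)) ∧
      (∀ᵐ t : ℝ, Tendsto (fun r => sliceSeries a r t) (𝓝[<] 1) (𝓝 (F t))) ∧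
      ∀ C : ℝ, 0 ≤ C → ∫⁻ t in Icc 0 Real.pi, ENNReal.ofReal (C * ∑ j, ‖F t j‖ ^ 2) =
        ENNReal.ofReal (C * Real.pi * ∑' n, ‖a n‖ ^ 2) := by
  choose F hFm hFt hFn using fun j => exists_boundaryFunction (coord a j) (summable_coord_sq ha j)
  have hm : AEMeasurable (fun t j => F j t) (volume.restrict (Icc 0 Real.pi)) :=
    aemeasurable_pi_lambda _ fun j => (hFm j).aemeasurable
  refine ⟨fun t j => F j t, hm, ?_, fun C hC => ?_⟩
  · filter_upwards [ae_all_iff.2 hFt] with t ht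
    exact tendsto_pi_nhds.2 ht
  · rw [lintegral_sum_norm_sq hm hC]
    simp only [hFn]
    exact sum_ofReal_coord ha hC

theorem lintegral_angularKernel_mul_le {a : ℕ → ℍ[ℝ]} (ha : MemHardy a) {r : ℝ}
    (hr : r ∈ Ioo (0 : ℝ) 1) :
    ∫⁻ t in Icc 0 Real.pi, ENNReal.ofReal (angularKernel r t) *
      ENNReal.ofReal (4 * Real.pi * ∑ j, ‖sliceSeries a r t j‖ ^ 2) ≤
        ENNReal.ofReal (Real.pi * Real.pi * ∑' n, ‖a n‖ ^ 2) := by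
  calc _ ≤ ∫⁻ t in Icc 0 Real.pi, ENNReal.ofReal (Real.pi * ∑ j, ‖sliceSeries a r t j‖ ^ 2) := by
        refine lintegral_mono fun t => ?_
        rw [← ENNReal.ofReal_mul (angularKernel_nonneg hr t)]
        apply ENNReal.ofReal_le_ofReal
        have h1 : 0 ≤ 4 * Real.pi * ∑ j, ‖sliceSeries a r t j‖ ^ 2 := by positivity
        have := mul_le_mul_of_nonneg_right (angularKernel_le hr t) h1
        linarith
    _ ≤ ENNReal.ofReal Real.pi * ∑ j, ENNReal.ofReal (Real.pi * ∑' n, coord a j n ^ 2) := by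
        rw [lintegral_sum_norm_sq (continuous_sliceSeries ha hr).measurable.aemeasurable Real.pi_pos.le]
        gcongr with j
        exact lintegral_norm_sq_powerSum_le _ (summable_coord_sq ha j) hr
    _ = _ := sum_ofReal_coord ha Real.pi_pos.le

/-- Fatou's lemma bounds the lower limit from below by the integral of the boundary functions, and
the estimate valid for every `r` bounds the upper limit by the same number. No maximal function or
convergence in `L²` is needed. -/
theorem tendsto_lintegral_angularKernel_mul {a : ℕ → ℍ[ℝ]} (ha : MemHardy a) :
    Tendsto (fun r => ∫⁻ t in Icc 0 Real.pi, ENNReal.ofReal (angularKernel r t) *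
      ENNReal.ofReal (4 * Real.pi * ∑ j, ‖sliceSeries a r t j‖ ^ 2)) (𝓝[<] 1)
        (𝓝 (ENNReal.ofReal (Real.pi * Real.pi * ∑' n, ‖a n‖ ^ 2))) := by
  obtain ⟨F, -, hFt, hFn⟩ := exists_boundarySeries ha
  have hIoo : ∀ᶠ r in 𝓝[<] (1 : ℝ), r ∈ Ioo (0 : ℝ) 1 := Ioo_mem_nhdsLT (by norm_num)
  classical
  -- The value `0` outside `(0, 1)` makes the integrand measurable for every `r`, as the form of
  -- Fatou's lemma used here requires.
  let f : ℝ → ℝ → ℝ≥0∞ := fun r t => if r ∈ Ioo (0 : ℝ) 1 then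
    ENNReal.ofReal (angularKernel r t) *
      ENNReal.ofReal (4 * Real.pi * ∑ j, ‖sliceSeries a r t j‖ ^ 2) else 0
  have hf : ∀ r ∈ Ioo (0 : ℝ) 1, f r = fun t => ENNReal.ofReal (angularKernel r t) *
      ENNReal.ofReal (4 * Real.pi * ∑ j, ‖sliceSeries a r t j‖ ^ 2) := fun r hr => by
    funext t; simp only [f, if_pos hr]
  have hfm : ∀ r, AEMeasurable (f r) (volume.restrict (Icc 0 Real.pi)) := fun r => by
    by_cases hr : r ∈ Ioo (0 : ℝ) 1
    · rw [hf r hr]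
      have h1 := continuous_angularKernel hr
      have h2 : ∀ j, Continuous fun t => sliceSeries a r t j := fun j =>
        (continuous_apply j).comp (continuous_sliceSeries ha hr)
      have h3 : Continuous fun t => 4 * Real.pi * ∑ j, ‖sliceSeries a r t j‖ ^ 2 := by fun_prop
      exact (h1.measurable.ennreal_ofReal.mul h3.measurable.ennreal_ofReal).aemeasurable
    · have : f r = fun _ => 0 := by funext t; simp only [f, if_neg hr]
      rw [this]
      exact aemeasurable_const
  have hlim : ∀ᵐ t ∂(volume.restrict (Icc 0 Real.pi)),
      ENNReal.ofReal (Real.pi * ∑ j, ‖F t j‖ ^ 2) = liminf (fun r => f r t) (𝓝[<] 1) := by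
    filter_upwards [ae_restrict_of_ae hFt, ae_sin_pos] with t h1 h2
    have h3 : Tendsto (fun r => angularKernel r t *
        (4 * Real.pi * ∑ j, ‖sliceSeries a r t j‖ ^ 2)) (𝓝[<] 1)
          (𝓝 (1 / 4 * (4 * Real.pi * ∑ j, ‖F t j‖ ^ 2))) :=
      (tendsto_angularKernel h2.ne').mul (Tendsto.const_mul _ (tendsto_finsetSum _ fun j _ =>
        ((tendsto_pi_nhds.1 h1 j).norm.pow 2)))
    have h4 : Tendsto (fun r => f r t) (𝓝[<] 1) (𝓝 (ENNReal.ofReal (Real.pi * ∑ j, ‖F t j‖ ^ 2))) := by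
      rw [show Real.pi * ∑ j, ‖F t j‖ ^ 2 = 1 / 4 * (4 * Real.pi * ∑ j, ‖F t j‖ ^ 2) by ring]
      refine (ENNReal.tendsto_ofReal h3).congr' ?_
      filter_upwards [hIoo] with r hr
      rw [hf r hr, ENNReal.ofReal_mul (angularKernel_nonneg hr t)]
    exact h4.liminf_eq.symm
  have hlow : ENNReal.ofReal (Real.pi * Real.pi * ∑' n, ‖a n‖ ^ 2) ≤
      liminf (fun r => ∫⁻ t in Icc 0 Real.pi, f r t) (𝓝[<] 1) := by
    rw [← hFn Real.pi Real.pi_pos.le, lintegral_congr_ae hlim]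
    exact lintegral_liminf_le' hfm
  have hup : limsup (fun r => ∫⁻ t in Icc 0 Real.pi, f r t) (𝓝[<] 1) ≤
      ENNReal.ofReal (Real.pi * Real.pi * ∑' n, ‖a n‖ ^ 2) := by
    refine limsup_le_of_le (by isBoundedDefault) ?_
    filter_upwards [hIoo] with r hr
    rw [hf r hr]
    exact lintegral_angularKernel_mul_le ha hr
  refine (tendsto_of_le_liminf_of_limsup_le hlow hup).congr' ?_
  filter_upwards [hIoo] with r hr
  rw [hf r hr]

/-! ### The induced volumes in polar coordinates -/

theorem sphereArea_eq_map (r : ℝ) :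
    sphereArea r = ENNReal.ofReal (r ^ 3) • (sphereArea 1).map fun q => r • q := by
  have h : sphereArea 1 = (volume : Measure ℍ[ℝ]).toSphere.map
      fun u : sphere (0 : ℍ[ℝ]) 1 => (u : ℍ[ℝ]) := by
    simp [sphereArea]
  rw [h, Measure.map_map (by fun_prop) (by fun_prop)]
  rfl

theorem lintegral_sphereArea (r : ℝ) {f : ℍ[ℝ] → ℝ≥0∞} (hf : Measurable f) :
    ∫⁻ q, f q ∂(sphereArea r) = ENNReal.ofReal (r ^ 3) * ∫⁻ p, ENNReal.ofReal (Real.sin p.1 ^ 2) *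
      f (r • polarPoint p.1 p.2) ∂angularMeasure := by
  rw [sphereArea_eq_map, lintegral_smul_measure, lintegral_map hf (by fun_prop),
    lintegral_sphereArea_one (f := fun q => f (r • q)) (by fun_prop), smul_eq_mul]

theorem ae_norm_sphereArea {r : ℝ} (hr : 0 < r) : ∀ᵐ q ∂(sphereArea r), ‖q‖ = r := by
  refine Measure.ae_smul_measure ?_ _
  rw [ae_map_iff (by fun_prop) (measurableSet_eq_fun (by fun_prop) (by fun_prop))]
  refine ae_of_all _ fun u => ?_
  rw [norm_smul, Real.norm_eq_abs, abs_of_pos hr]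
  simp

theorem measurable_polarPoint : Measurable fun p : ℝ × sphere (0 : EuclideanSpace ℝ (Fin 3)) 1 =>
    polarPoint p.1 p.2 := continuous_polarPoint.measurable

theorem measurable_quaternion_re : Measurable fun q : ℍ[ℝ] => q.re :=
  Quaternion.continuous_re.measurable

/-- The factor `r³ sin² t` of the surface measure multiplies the density `1/((1 - r²)((1 - r²)² +
4r² sin² t))`. -/
theorem sphereVol_eq_map {r : ℝ} (hr : r ∈ Ioo (0 : ℝ) 1) :
    sphereVol r = (angularMeasure.withDensity fun p =>
      ENNReal.ofReal ((1 - r ^ 2)⁻¹) * ENNReal.ofReal (angularKernel r p.1)).map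
        fun p => r • polarPoint p.1 p.2 := by
  have hr2 : 0 < 1 - r ^ 2 := by nlinarith [hr.1, hr.2]
  obtain ⟨D, hD⟩ : ∃ D : ℍ[ℝ] → ℝ≥0∞, D = fun q => ENNReal.ofReal (((1 - r ^ 2) *
    ((1 - r ^ 2) ^ 2 + 4 * (r ^ 2 - q.re ^ 2)))⁻¹) := ⟨_, rfl⟩
  have hDm : Measurable D := by
    have := measurable_quaternion_re
    rw [hD]; fun_prop
  have hae : volDensity =ᵐ[sphereArea r] D := by
    filter_upwards [ae_norm_sphereArea hr.1] with q hq
    rw [volDensity_eq (norm_pos_iff.1 (hq ▸ hr.1)) (hq ▸ hr.2), hq, hD]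
  have hΦ : Measurable fun p : ℝ × sphere (0 : EuclideanSpace ℝ (Fin 3)) 1 =>
    r • polarPoint p.1 p.2 := measurable_polarPoint.const_smul r
  rw [sphereVol, withDensity_congr_ae hae]
  ext s hs
  rw [withDensity_apply _ hs, ← lintegral_indicator hs, lintegral_sphereArea r (hDm.indicator hs),
    Measure.map_apply hΦ hs, withDensity_apply _ (hΦ hs), ← lintegral_indicator (hΦ hs),
    ← lintegral_const_mul]
  · congr 1
    funext p
    by_cases hp : r • polarPoint p.1 p.2 ∈ s
    · rw [indicator_of_mem hp, indicator_of_mem (show p ∈ (fun p : ℝ ×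
        sphere (0 : EuclideanSpace ℝ (Fin 3)) 1 => r • polarPoint p.1 p.2) ⁻¹' s from hp), hD]
      have hc : r ^ 2 - (r * Real.cos p.1) ^ 2 = r ^ 2 * Real.sin p.1 ^ 2 := by
        rw [Real.sin_sq]; ring
      simp only [Quaternion.re_smul, re_polarPoint, smul_eq_mul, hc]
      have := angularKernel_denom_pos hr p.1
      rw [← ENNReal.ofReal_mul (by positivity), ← ENNReal.ofReal_mul (pow_nonneg hr.1.le 3),
        ← ENNReal.ofReal_mul (by positivity), angularKernel]
      congr 1
      field_simp
    · rw [indicator_of_notMem hp, indicator_of_notMem (show p ∉ (fun p : ℝ ×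
        sphere (0 : EuclideanSpace ℝ (Fin 3)) 1 => r • polarPoint p.1 p.2) ⁻¹' s from hp),
        mul_zero, mul_zero]
  · have := (hDm.indicator hs).comp hΦ
    exact (Measurable.ennreal_ofReal (by fun_prop)).mul this

theorem tendsto_scaledDensity {u : ℍ[ℝ]} (hu : ‖u‖ = 1) :
    Tendsto (fun r : ℝ => scaledDensity r u) (𝓝[<] 1)
      (𝓝 ((ENNReal.ofReal (4 * (1 - u.re ^ 2)))⁻¹)) := by
  have hre : 0 ≤ 1 - u.re ^ 2 := by
    have := norm_sq_eq u
    rw [hu] at this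
    nlinarith [sq_nonneg u.imI, sq_nonneg u.imJ, sq_nonneg u.imK]
  -- The quotient is formed in `ℝ≥0∞`, so that the points `u = ±1`, where the denominator tends to
  -- `0`, are included with limit `∞`.
  have h1 : Tendsto (fun r : ℝ => ENNReal.ofReal (r ^ 3) /
      ENNReal.ofReal ((1 - r ^ 2) ^ 2 + 4 * (r ^ 2 * (1 - u.re ^ 2)))) (𝓝[<] 1)
        (𝓝 ((ENNReal.ofReal (4 * (1 - u.re ^ 2)))⁻¹)) := by
    have e1 : Tendsto (fun r : ℝ => ENNReal.ofReal (r ^ 3)) (𝓝[<] 1) (𝓝 1) := by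
      have : Continuous fun r : ℝ => r ^ 3 := by fun_prop
      simpa using ENNReal.tendsto_ofReal ((this.tendsto 1).mono_left nhdsWithin_le_nhds)
    have e2 : Tendsto (fun r : ℝ => ENNReal.ofReal ((1 - r ^ 2) ^ 2 +
        4 * (r ^ 2 * (1 - u.re ^ 2)))) (𝓝[<] 1) (𝓝 (ENNReal.ofReal (4 * (1 - u.re ^ 2)))) := by
      have : Continuous fun r : ℝ => (1 - r ^ 2) ^ 2 + 4 * (r ^ 2 * (1 - u.re ^ 2)) := by fun_prop
      have h := ENNReal.tendsto_ofReal ((this.tendsto 1).mono_left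
        (nhdsWithin_le_nhds (s := Iio (1 : ℝ))))
      simpa using h
    simpa using ENNReal.Tendsto.div e1 (Or.inl one_ne_zero) e2 (Or.inr ENNReal.one_ne_top)
  refine h1.congr' ?_
  filter_upwards [Ioo_mem_nhdsLT (show (0 : ℝ) < 1 by norm_num)] with r hr
  have hn : ‖r • u‖ = r := by rw [norm_smul, hu, mul_one, Real.norm_eq_abs, abs_of_pos hr.1]
  have hr2 : 0 < 1 - r ^ 2 := by nlinarith [hr.1, hr.2]
  have hpos : 0 < (1 - r ^ 2) ^ 2 + 4 * (r ^ 2 * (1 - u.re ^ 2)) := by positivity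
  rw [scaledDensity, volDensity_eq (norm_pos_iff.1 (hn.symm ▸ hr.1)) (hn.symm ▸ hr.2), hn,
    ← ENNReal.ofReal_div_of_pos hpos, ← ENNReal.ofReal_mul (pow_nonneg hr.1.le 3),
    ← ENNReal.ofReal_mul hr2.le, Quaternion.re_smul, smul_eq_mul,
    show r ^ 2 - (r * u.re) ^ 2 = r ^ 2 * (1 - u.re ^ 2) by ring]
  congr 1
  field_simp

theorem boundaryDensity_eq {u : ℍ[ℝ]} (hu : ‖u‖ = 1) :
    boundaryDensity u = (ENNReal.ofReal (4 * (1 - u.re ^ 2)))⁻¹ :=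
  (tendsto_scaledDensity hu).limUnder_eq

theorem polarVol_eq : polarVol =
    (1 / 4 : ℝ≥0∞) • angularMeasure.map fun p => polarPoint p.1 p.2 := rfl

theorem ae_angularMeasure_of_ae {P : ℝ → Prop}
    (h : ∀ᵐ t ∂(volume.restrict (Icc 0 Real.pi)), P t) : ∀ᵐ p ∂angularMeasure, P p.1 :=
  Measure.quasiMeasurePreserving_fst.ae h

/-- The boundary density `1/(4 sin² t)` cancels the factor `sin² t` of the surface measure, except
on the null set `sin t = 0`. -/
theorem boundaryVol_eq_polarVol : boundaryVol = polarVol := by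
  obtain ⟨D, hD⟩ : ∃ D : ℍ[ℝ] → ℝ≥0∞, D = fun u => (ENNReal.ofReal (4 * (1 - u.re ^ 2)))⁻¹ :=
    ⟨_, rfl⟩
  have hDm : Measurable D := by
    have := measurable_quaternion_re
    rw [hD]; fun_prop
  have hae : boundaryDensity =ᵐ[sphereArea 1] D := by
    filter_upwards [ae_norm_sphereArea one_pos] with q hq
    rw [boundaryDensity_eq hq, hD]
  rw [boundaryVol, withDensity_congr_ae hae, polarVol_eq]
  ext s hs
  have hΦs := measurable_polarPoint hs
  rw [withDensity_apply _ hs, ← lintegral_indicator hs, lintegral_sphereArea_one (hDm.indicator hs),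
    Measure.smul_apply, Measure.map_apply measurable_polarPoint hs, ← lintegral_indicator_one hΦs,
    smul_eq_mul, ← lintegral_const_mul _ (measurable_one.indicator hΦs)]
  refine lintegral_congr_ae ?_
  filter_upwards [ae_angularMeasure_of_ae ae_sin_pos] with p hp
  by_cases h : polarPoint p.1 p.2 ∈ s
  · rw [indicator_of_mem h, indicator_of_mem (show p ∈ (fun p : ℝ ×
      sphere (0 : EuclideanSpace ℝ (Fin 3)) 1 => polarPoint p.1 p.2) ⁻¹' s from h), hD]
    simp only [re_polarPoint, ← Real.sin_sq, Pi.one_apply, mul_one]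
    rw [← ENNReal.ofReal_inv_of_pos (by positivity), ← ENNReal.ofReal_mul (by positivity)]
    have : Real.sin p.1 ^ 2 * (4 * Real.sin p.1 ^ 2)⁻¹ = 4⁻¹ := by field_simp
    rw [this, ENNReal.ofReal_inv_of_pos (by norm_num)]
    simp
  · rw [indicator_of_notMem h, indicator_of_notMem (show p ∉ (fun p : ℝ ×
      sphere (0 : EuclideanSpace ℝ (Fin 3)) 1 => polarPoint p.1 p.2) ⁻¹' s from h),
      mul_zero, mul_zero]

theorem angularMeasure_univ : angularMeasure univ = ENNReal.ofReal (4 * Real.pi ^ 2) := by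
  rw [angularMeasure, ← univ_prod_univ, Measure.prod_prod, toSphere_univ_fin_three,
    Measure.restrict_apply_univ, Real.volume_Icc, sub_zero, ← ENNReal.ofReal_mul Real.pi_pos.le]
  congr 1
  ring

theorem polarVol_sphere : polarVol (sphere 0 1) = ENNReal.ofReal (Real.pi ^ 2) := by
  have h : (fun p : ℝ × sphere (0 : EuclideanSpace ℝ (Fin 3)) 1 => polarPoint p.1 p.2) ⁻¹'
      sphere 0 1 = univ := eq_univ_of_forall fun p => by simp [norm_polarPoint]
  rw [polarVol_eq, Measure.smul_apply, Measure.map_apply measurable_polarPoint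
    isClosed_sphere.measurableSet, h, angularMeasure_univ, smul_eq_mul,
    show (1 / 4 : ℝ≥0∞) = ENNReal.ofReal (1 / 4) by
      rw [ENNReal.ofReal_div_of_pos (by norm_num)]; simp, ← ENNReal.ofReal_mul (by norm_num)]
  congr 1
  ring

theorem ae_polarVol_norm : ∀ᵐ u ∂polarVol, ‖u‖ = 1 := by
  rw [polarVol_eq]
  refine Measure.ae_smul_measure ?_ _
  rw [ae_map_iff measurable_polarPoint.aemeasurable
    (measurableSet_eq_fun (by fun_prop) (by fun_prop))]
  exact ae_of_all _ fun p => norm_polarPoint _ _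

/-- The angle is a function of `u`, while at `u = ±1` any `I` serves. Statements about the angle can
thus be transferred to the sphere without inverting the coordinates. -/
theorem exists_eq_polarPoint_arccos {u : ℍ[ℝ]} (hu : ‖u‖ = 1) :
    ∃ I, u = polarPoint (Real.arccos u.re) I := by
  have hn := norm_sq_eq u
  rw [hu, one_pow] at hn
  have hre : Real.cos (Real.arccos u.re) = u.re := by
    apply Real.cos_arccos <;>
      nlinarith [sq_nonneg u.imI, sq_nonneg u.imJ, sq_nonneg u.imK, sq_nonneg (u.re + 1),
        sq_nonneg (u.re - 1)]
  set s := Real.sin (Real.arccos u.re) with hs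
  have hs2 : s ^ 2 = u.imI ^ 2 + u.imJ ^ 2 + u.imK ^ 2 := by
    rw [hs, Real.sin_sq, hre]; linarith
  by_cases h0 : s = 0
  · rw [h0] at hs2
    have hI : u.imI = 0 := by nlinarith [sq_nonneg u.imI, sq_nonneg u.imJ, sq_nonneg u.imK]
    have hJ : u.imJ = 0 := by nlinarith [sq_nonneg u.imI, sq_nonneg u.imJ, sq_nonneg u.imK]
    have hK : u.imK = 0 := by nlinarith [sq_nonneg u.imI, sq_nonneg u.imJ, sq_nonneg u.imK]
    refine ⟨⟨EuclideanSpace.single 0 1, by simp⟩, ?_⟩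
    ext <;> simp [polarPoint, imUnit, hre, ← hs, h0, hI, hJ, hK]
  · refine ⟨⟨!₂[u.imI / s, u.imJ / s, u.imK / s], ?_⟩, ?_⟩
    · rw [mem_sphere_zero_iff_norm, ← sq_eq_sq₀ (norm_nonneg _) zero_le_one,
        EuclideanSpace.norm_sq_eq, Fin.sum_univ_three]
      simp [div_pow, ← add_div]
      rw [← hs2, div_self (pow_ne_zero 2 h0)]
    · ext <;> simp [polarPoint, imUnit, hre, ← hs] <;> field_simp

/-- Almost everywhere statements about the angle are almost everywhere statements on the sphere. -/
theorem ae_polarVol_of_ae {P : ℝ → Prop} (h : ∀ᵐ t : ℝ, P t) :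
    ∀ᵐ u ∂polarVol, P (Real.arccos u.re) := by
  have hm : Measurable fun u : ℍ[ℝ] => Real.arccos u.re :=
    Real.measurable_arccos.comp measurable_quaternion_re
  -- The predicate `P` need not be measurable; its exceptional set is enlarged to a measurable null
  -- set before passing to the image measure.
  have hs : ∀ᵐ t : ℝ, t ∈ (toMeasurable volume {t | ¬ P t})ᶜ := by
    rw [ae_iff]
    simpa using (ae_iff.1 h)
  have key : ∀ᵐ u ∂polarVol, Real.arccos u.re ∈ (toMeasurable volume {t | ¬ P t})ᶜ := by
    rw [polarVol_eq]
    refine Measure.ae_smul_measure ?_ _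
    rw [ae_map_iff measurable_polarPoint.aemeasurable
      (hm (measurableSet_toMeasurable _ _).compl)]
    filter_upwards [ae_angularMeasure_of_ae (ae_restrict_of_ae hs),
      ae_angularMeasure_of_ae (ae_restrict_mem measurableSet_Icc)] with p h1 h2
    rwa [re_polarPoint, Real.arccos_cos h2.1 h2.2]
  filter_upwards [key] with u hu
  by_contra hP
  exact hu (subset_toMeasurable _ _ hP)

/-! ### Integrals of power series over spheres -/

theorem summable_norm_pow_mul {a : ℕ → ℍ[ℝ]} (ha : MemHardy a) {ρ : ℝ} (h0 : 0 ≤ ρ) (h1 : ρ < 1) :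
    Summable fun n => ρ ^ n * ‖a n‖ := by
  have h2 : Summable fun n => (ρ ^ n) ^ 2 := by
    simp only [← pow_mul, mul_comm _ 2]
    simp only [pow_mul]
    exact summable_geometric_of_lt_one (by positivity) (by nlinarith)
  refine (ha.add h2).of_nonneg_of_le (fun n => by positivity) fun n => ?_
  nlinarith [sq_nonneg (‖a n‖ - ρ ^ n), sq_nonneg (‖a n‖), sq_nonneg (ρ ^ n)]

theorem summable_eval {a : ℕ → ℍ[ℝ]} (ha : MemHardy a) {q : ℍ[ℝ]} (hq : ‖q‖ < 1) :
    Summable fun n => q ^ n * a n := by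
  refine Summable.of_norm ?_
  simpa only [norm_mul, norm_pow] using summable_norm_pow_mul ha (norm_nonneg q) hq

theorem continuousOn_eval {a : ℕ → ℍ[ℝ]} (ha : MemHardy a) : ContinuousOn (eval a) (ball 0 1) := by
  intro z hz
  rw [mem_ball_zero_iff] at hz
  obtain ⟨ρ, h1, h2⟩ := exists_between hz
  have h0 : 0 ≤ ρ := (norm_nonneg z).trans h1.le
  have : ContinuousOn (eval a) (ball 0 ρ) := by
    refine continuousOn_tsum (fun n => by fun_prop) (summable_norm_pow_mul ha h0 h2) fun n w hw => ?_
    rw [norm_mul, norm_pow]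
    rw [mem_ball_zero_iff] at hw
    gcongr
  exact (this.continuousAt (isOpen_ball.mem_nhds (by simpa using h1))).continuousWithinAt

theorem eval_smul_polarPoint {a : ℕ → ℍ[ℝ]} (ha : MemHardy a) {r : ℝ} (hr : r ∈ Ioo (0 : ℝ) 1)
    (t : ℝ) (I : sphere (0 : EuclideanSpace ℝ (Fin 3)) 1) :
    eval a (r • polarPoint t I) = combine (sliceSeries a r t) I :=
  (hasSum_eval_polarPoint ha hr t I).tsum_eq

theorem sphereVol_restrict {r : ℝ} (hr : r ∈ Ioo (0 : ℝ) 1) :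
    (sphereVol r).restrict (sphere 0 r) = sphereVol r := by
  refine Measure.restrict_eq_self_of_ae_mem ?_
  refine (withDensity_absolutelyContinuous _ _).ae_le ?_
  filter_upwards [ae_norm_sphereArea hr.1] with q hq
  simpa using hq

theorem aestronglyMeasurable_eval_sphereVol {a : ℕ → ℍ[ℝ]} (ha : MemHardy a) {r : ℝ}
    (hr : r ∈ Ioo (0 : ℝ) 1) : AEStronglyMeasurable (eval a) (sphereVol r) := by
  rw [← sphereVol_restrict hr]
  exact ((continuousOn_eval ha).mono fun q hq => by
    rw [mem_sphere_zero_iff_norm] at hq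
    rw [mem_ball_zero_iff, hq]
    exact hr.2).aestronglyMeasurable isClosed_sphere.measurableSet

/-- The integral of `|f|²` over `r 𝕊³`, multiplied by `1 - r²`. -/
noncomputable def weightedIntegral (a : ℕ → ℍ[ℝ]) (r : ℝ) : ℝ≥0∞ :=
  ∫⁻ t in Icc 0 Real.pi, ENNReal.ofReal (angularKernel r t) *
    ENNReal.ofReal (4 * Real.pi * ∑ j, ‖sliceSeries a r t j‖ ^ 2)

theorem lintegral_norm_sq_eval_sphereVol {a : ℕ → ℍ[ℝ]} (ha : MemHardy a) {r : ℝ}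
    (hr : r ∈ Ioo (0 : ℝ) 1) :
    ∫⁻ q, ENNReal.ofReal (‖eval a q‖ ^ 2) ∂(sphereVol r) =
      ENNReal.ofReal ((1 - r ^ 2)⁻¹) * weightedIntegral a r := by
  have hΦ : Measurable fun p : ℝ × sphere (0 : EuclideanSpace ℝ (Fin 3)) 1 =>
    r • polarPoint p.1 p.2 := measurable_polarPoint.const_smul r
  have hκ : Measurable fun t => ENNReal.ofReal (angularKernel r t) :=
    (continuous_angularKernel hr).measurable.ennreal_ofReal
  have hm : AEMeasurable (fun q => ENNReal.ofReal (‖eval a q‖ ^ 2)) (sphereVol r) :=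
    ((aestronglyMeasurable_eval_sphereVol ha hr).aemeasurable.norm.pow_const 2).ennreal_ofReal
  have hκ1 : Measurable fun p : ℝ × sphere (0 : EuclideanSpace ℝ (Fin 3)) 1 =>
      ENNReal.ofReal (angularKernel r p.1) := hκ.comp measurable_fst
  have hκ2 : Measurable fun p : ℝ × sphere (0 : EuclideanSpace ℝ (Fin 3)) 1 =>
      ENNReal.ofReal ((1 - r ^ 2)⁻¹) * ENNReal.ofReal (angularKernel r p.1) := hκ1.const_mul _
  have hcm : Measurable fun p : ℝ × sphere (0 : EuclideanSpace ℝ (Fin 3)) 1 =>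
      ENNReal.ofReal (‖combine (sliceSeries a r p.1) p.2‖ ^ 2) := by
    have h1 : Continuous fun p : ℝ × sphere (0 : EuclideanSpace ℝ (Fin 3)) 1 =>
        (sliceSeries a r p.1, p.2) :=
      ((continuous_sliceSeries ha hr).comp continuous_fst).prodMk continuous_snd
    exact ((continuous_combine.comp h1).norm.pow 2).measurable.ennreal_ofReal
  rw [sphereVol_eq_map hr] at hm ⊢
  rw [lintegral_map' hm hΦ.aemeasurable]
  simp only [eval_smul_polarPoint ha hr]
  rw [lintegral_withDensity_eq_lintegral_mul _ hκ2 hcm]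
  simp only [Pi.mul_apply, mul_assoc]
  rw [lintegral_const_mul _ (by exact hκ1.mul hcm),
    lintegral_angularMeasure_combine hκ (continuous_sliceSeries ha hr).measurable.aemeasurable,
    weightedIntegral]

theorem weightedIntegral_ne_top {a : ℕ → ℍ[ℝ]} (ha : MemHardy a) {r : ℝ} (hr : r ∈ Ioo (0 : ℝ) 1) :
    weightedIntegral a r ≠ ∞ :=
  ne_top_of_le_ne_top ENNReal.ofReal_ne_top (lintegral_angularKernel_mul_le ha hr)

theorem integrable_norm_sq_eval_sphereVol {a : ℕ → ℍ[ℝ]} (ha : MemHardy a) {r : ℝ}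
    (hr : r ∈ Ioo (0 : ℝ) 1) : Integrable (fun q => ‖eval a q‖ ^ 2) (sphereVol r) := by
  refine ⟨(aestronglyMeasurable_eval_sphereVol ha hr).norm.pow 2, ?_⟩
  rw [hasFiniteIntegral_iff_ofReal (ae_of_all _ fun q => by positivity),
    lintegral_norm_sq_eval_sphereVol ha hr]
  exact ENNReal.mul_lt_top ENNReal.ofReal_lt_top (weightedIntegral_ne_top ha hr).lt_top

theorem mul_integral_norm_sq_eval {a : ℕ → ℍ[ℝ]} (ha : MemHardy a) {r : ℝ} (hr : r ∈ Ioo (0 : ℝ) 1) :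
    (1 - r ^ 2) * ∫ q in sphere 0 r, ‖eval a q‖ ^ 2 ∂(sphereVol r) =
      (weightedIntegral a r).toReal := by
  have hr2 : 0 < 1 - r ^ 2 := by nlinarith [hr.1, hr.2]
  rw [sphereVol_restrict hr, integral_eq_lintegral_of_nonneg_ae (ae_of_all _ fun q => by positivity)
    (integrable_norm_sq_eval_sphereVol ha hr).aestronglyMeasurable, lintegral_norm_sq_eval_sphereVol ha hr,
    ENNReal.toReal_mul, ENNReal.toReal_ofReal (by positivity), mul_inv_cancel_left₀ hr2.ne']

theorem tendsto_weightedIntegral {a : ℕ → ℍ[ℝ]} (ha : MemHardy a) :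
    Tendsto (fun r => (weightedIntegral a r).toReal) (𝓝[<] 1)
      (𝓝 (Real.pi ^ 2 * ∑' n, ‖a n‖ ^ 2)) := by
  have h := (ENNReal.tendsto_toReal ENNReal.ofReal_ne_top).comp
    (tendsto_lintegral_angularKernel_mul ha)
  have h0 : 0 ≤ ∑' n, ‖a n‖ ^ 2 := tsum_nonneg fun n => by positivity
  rw [ENNReal.toReal_ofReal (by positivity), ← sq] at h
  exact h

/-! ### The volume of the spheres, from the constant series 1 -/

theorem memHardy_one : MemHardy (Pi.single 0 1) :=
  summable_of_ne_finset_zero (s := {0}) fun n hn => by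
    have : n ≠ 0 := by simpa using hn
    simp [this]

theorem eval_one (q : ℍ[ℝ]) : eval (Pi.single 0 1) q = 1 := by
  rw [eval, tsum_eq_single 0 fun n hn => by simp [hn]]
  simp

theorem tsum_norm_sq_one : ∑' n, ‖(Pi.single 0 1 : ℕ → ℍ[ℝ]) n‖ ^ 2 = 1 := by
  rw [tsum_eq_single 0 fun n hn => by simp [hn]]
  simp

theorem sphereVol_sphere {r : ℝ} (hr : r ∈ Ioo (0 : ℝ) 1) :
    sphereVol r (sphere 0 r) = ENNReal.ofReal ((1 - r ^ 2)⁻¹) * weightedIntegral (Pi.single 0 1) r := by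
  rw [← lintegral_norm_sq_eval_sphereVol memHardy_one hr]
  simp only [eval_one, norm_one, one_pow, ENNReal.ofReal_one, lintegral_one]
  rw [← Measure.restrict_apply_univ, sphereVol_restrict hr]

/-- The density in angular coordinates is positive almost everywhere, and the angular measure is not
zero. -/
theorem sphereVol_sphere_pos {r : ℝ} (hr : r ∈ Ioo (0 : ℝ) 1) : 0 < sphereVol r (sphere 0 r) := by
  have hr2 : 0 < 1 - r ^ 2 := by nlinarith [hr.1, hr.2]
  rw [← Measure.restrict_apply_univ, sphereVol_restrict hr, pos_iff_ne_zero]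
  intro h0
  have hΦ : Measurable fun p : ℝ × sphere (0 : EuclideanSpace ℝ (Fin 3)) 1 =>
    r • polarPoint p.1 p.2 := measurable_polarPoint.const_smul r
  have hκ : Measurable fun p : ℝ × sphere (0 : EuclideanSpace ℝ (Fin 3)) 1 =>
      ENNReal.ofReal ((1 - r ^ 2)⁻¹) * ENNReal.ofReal (angularKernel r p.1) :=
    ((continuous_angularKernel hr).measurable.ennreal_ofReal.comp measurable_fst).const_mul _
  rw [sphereVol_eq_map hr, Measure.map_apply hΦ .univ, preimage_univ, withDensity_apply _ .univ,
    Measure.restrict_univ, lintegral_eq_zero_iff hκ] at h0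
  have hfalse : ∀ᵐ p ∂angularMeasure, False := by
    filter_upwards [h0, ae_angularMeasure_of_ae ae_sin_pos] with p h1 h2
    have h3 : 0 < angularKernel r p.1 :=
      div_pos (mul_pos (pow_pos hr.1 3) (pow_pos h2 2)) (angularKernel_denom_pos hr p.1)
    simp only [Pi.zero_apply, mul_eq_zero, ENNReal.ofReal_eq_zero, not_le.2 h3, or_false] at h1
    exact absurd h1 (not_le.2 (inv_pos.2 hr2))
  have huniv := angularMeasure_univ
  have h4 : angularMeasure univ = 0 := by simpa [ae_iff] using hfalse
  rw [h4, eq_comm, ENNReal.ofReal_eq_zero] at huniv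
  have := Real.pi_pos
  exact absurd huniv (not_le.2 (by positivity))

theorem sphereVol_sphere_lt_top {r : ℝ} (hr : r ∈ Ioo (0 : ℝ) 1) :
    sphereVol r (sphere 0 r) < ∞ := by
  rw [sphereVol_sphere hr]
  exact ENNReal.mul_lt_top ENNReal.ofReal_lt_top (weightedIntegral_ne_top memHardy_one hr).lt_top

theorem mul_sphereVol_real {r : ℝ} (hr : r ∈ Ioo (0 : ℝ) 1) :
    (1 - r ^ 2) * (sphereVol r).real (sphere 0 r) =
      (weightedIntegral (Pi.single 0 1) r).toReal := by
  have hr2 : 0 < 1 - r ^ 2 := by nlinarith [hr.1, hr.2]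
  rw [measureReal_def, sphereVol_sphere hr, ENNReal.toReal_mul,
    ENNReal.toReal_ofReal (by positivity), mul_inv_cancel_left₀ hr2.ne']

theorem hardyNorm_sq (a : ℕ → ℍ[ℝ]) : hardyNorm a ^ 2 = ∑' n, ‖a n‖ ^ 2 :=
  Real.sq_sqrt (tsum_nonneg fun n => by positivity)

/-- Both the integral and the volume, multiplied by `1 - r²`, converge: to `π² ‖f‖²` and to `π²`.
The factor cancels in the quotient. -/
theorem tendsto_average {a : ℕ → ℍ[ℝ]} (ha : MemHardy a) :
    Tendsto (fun r : ℝ => 1 / (sphereVol r).real (sphere 0 r) *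
      ∫ q in sphere 0 r, ‖eval a q‖ ^ 2 ∂(sphereVol r)) (𝓝[<] 1) (𝓝 (hardyNorm a ^ 2)) := by
  have h1 := (tendsto_weightedIntegral ha).div (tendsto_weightedIntegral memHardy_one)
    (by rw [tsum_norm_sq_one]; positivity)
  rw [tsum_norm_sq_one, mul_one, mul_div_cancel_left₀ _ (by positivity), ← hardyNorm_sq] at h1
  refine h1.congr' ?_
  filter_upwards [Ioo_mem_nhdsLT (show (0 : ℝ) < 1 by norm_num)] with r hr
  have hr2 : 0 < 1 - r ^ 2 := by nlinarith [hr.1, hr.2]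
  simp only [Pi.div_apply]
  rw [← mul_integral_norm_sq_eval ha hr, ← mul_sphereVol_real hr, mul_div_mul_left _ _ hr2.ne',
    one_div_mul_eq_div]

theorem tendsto_scaled_integral {a : ℕ → ℍ[ℝ]} (ha : MemHardy a) :
    Tendsto (fun r : ℝ => (1 - r ^ 2) / Real.pi ^ 2 *
      ∫ q in sphere 0 r, ‖eval a q‖ ^ 2 ∂(sphereVol r)) (𝓝[<] 1) (𝓝 (hardyNorm a ^ 2)) := by
  have h1 := (tendsto_weightedIntegral ha).div_const (Real.pi ^ 2)
  rw [mul_div_cancel_left₀ _ (by positivity), ← hardyNorm_sq] at h1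
  refine h1.congr' ?_
  filter_upwards [Ioo_mem_nhdsLT (show (0 : ℝ) < 1 by norm_num)] with r hr
  rw [← mul_integral_norm_sq_eval ha hr, div_mul_eq_mul_div]

/-! ### Boundary values -/

theorem tendsto_eval_polarPoint {a : ℕ → ℍ[ℝ]} (ha : MemHardy a) {t : ℝ}
    {z : Fin (Module.finrank ℝ ℍ[ℝ]) → ℂ}
    (h : Tendsto (fun r => sliceSeries a r t) (𝓝[<] 1) (𝓝 z))
    (I : sphere (0 : EuclideanSpace ℝ (Fin 3)) 1) :
    Tendsto (fun r : ℝ => eval a (r • polarPoint t I)) (𝓝[<] 1) (𝓝 (combine z I)) := by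
  have h1 : Tendsto (fun x => combine x I) (𝓝 z) (𝓝 (combine z I)) :=
    (continuous_combine.comp (Continuous.prodMk_left I)).tendsto z
  refine (h1.comp h).congr' ?_
  filter_upwards [Ioo_mem_nhdsLT (show (0 : ℝ) < 1 by norm_num)] with r hr
  exact (eval_smul_polarPoint ha hr t I).symm

/-- The exceptional set depends on the angle only: once the four coordinate series converge at `t`,
the radial limit exists at `e^{tI}` for every `I`. -/
theorem ae_tendsto_radialLimit {a : ℕ → ℍ[ℝ]} (ha : MemHardy a) :
    ∀ᵐ u ∂polarVol, Tendsto (fun r : ℝ => eval a (r • u)) (𝓝[<] 1)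
      (𝓝 (radialLimit (eval a) u)) := by
  obtain ⟨F, -, hF, -⟩ := exists_boundarySeries ha
  filter_upwards [ae_polarVol_of_ae hF, ae_polarVol_norm] with u h1 h2
  obtain ⟨I, hI⟩ := exists_eq_polarPoint_arccos h2
  have h3 := tendsto_eval_polarPoint ha h1 I
  rw [← hI] at h3
  rw [radialLimit, h3.limUnder_eq]
  exact h3

theorem polarVol_restrict : polarVol.restrict (sphere 0 1) = polarVol :=
  Measure.restrict_eq_self_of_ae_mem (ae_polarVol_norm.mono fun u hu => by simpa using hu)

theorem aestronglyMeasurable_radialLimit {a : ℕ → ℍ[ℝ]} (ha : MemHardy a) :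
    AEStronglyMeasurable (radialLimit (eval a)) polarVol := by
  -- Measurability passes to almost everywhere limits of sequences, so the radial limit is taken
  -- along a sequence of radii.
  obtain ⟨ρ, -, hρ, hρ1⟩ := exists_seq_strictMono_tendsto' (show (0 : ℝ) < 1 by norm_num)
  have hρ' : Tendsto ρ atTop (𝓝[<] 1) :=
    tendsto_nhdsWithin_iff.2 ⟨hρ1, Eventually.of_forall fun n => (hρ n).2⟩
  refine aestronglyMeasurable_of_tendsto_ae atTop (f := fun n u => eval a (ρ n • u)) (fun n => ?_) ?_
  · rw [← polarVol_restrict]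
    refine ContinuousOn.aestronglyMeasurable ?_ isClosed_sphere.measurableSet
    refine (continuousOn_eval ha).comp (by fun_prop) fun u hu => ?_
    rw [mem_sphere_zero_iff_norm] at hu
    rw [mem_ball_zero_iff, norm_smul, hu, mul_one, Real.norm_eq_abs, abs_of_pos (hρ n).1]
    exact (hρ n).2
  · filter_upwards [ae_tendsto_radialLimit ha] with u hu
    exact hu.comp hρ'

theorem lintegral_norm_sq_radialLimit {a : ℕ → ℍ[ℝ]} (ha : MemHardy a) :
    ∫⁻ u, ENNReal.ofReal (‖radialLimit (eval a) u‖ ^ 2) ∂polarVol =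
      ENNReal.ofReal (Real.pi ^ 2 * ∑' n, ‖a n‖ ^ 2) := by
  obtain ⟨F, hFm, hF, hFn⟩ := exists_boundarySeries ha
  have hm : AEMeasurable (fun u => ENNReal.ofReal (‖radialLimit (eval a) u‖ ^ 2))
      (angularMeasure.map fun p => polarPoint p.1 p.2) := by
    have := ((aestronglyMeasurable_radialLimit ha).aemeasurable.norm.pow_const 2).ennreal_ofReal
    rw [polarVol_eq] at this
    exact (aemeasurable_smul_measure_iff (by simp)).1 this
  have hae : ∀ᵐ p ∂angularMeasure, ENNReal.ofReal (‖radialLimit (eval a) (polarPoint p.1 p.2)‖ ^ 2) =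
      1 * ENNReal.ofReal (‖combine (F p.1) p.2‖ ^ 2) := by
    filter_upwards [ae_angularMeasure_of_ae (ae_restrict_of_ae hF)] with p hp
    rw [radialLimit, (tendsto_eval_polarPoint ha hp p.2).limUnder_eq, one_mul]
  rw [polarVol_eq, lintegral_smul_measure, lintegral_map' hm measurable_polarPoint.aemeasurable,
    lintegral_congr_ae hae, lintegral_angularMeasure_combine (w := fun _ => 1) measurable_const hFm]
  simp only [one_mul]
  -- Here `C = 4π` comes from the integration over `𝕊`; with the weight `1/4` the total is `(1/4) ·
  -- 4π · π = π²`.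
  rw [hFn _ (by positivity), smul_eq_mul, show (1 / 4 : ℝ≥0∞) = ENNReal.ofReal (1 / 4) by
      rw [ENNReal.ofReal_div_of_pos (by norm_num)]; simp, ← ENNReal.ofReal_mul (by norm_num)]
  congr 1
  ring

theorem integrable_norm_sq_radialLimit {a : ℕ → ℍ[ℝ]} (ha : MemHardy a) :
    Integrable (fun u => ‖radialLimit (eval a) u‖ ^ 2) polarVol := by
  refine ⟨(aestronglyMeasurable_radialLimit ha).norm.pow 2, ?_⟩
  rw [hasFiniteIntegral_iff_ofReal (ae_of_all _ fun q => by positivity),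
    lintegral_norm_sq_radialLimit ha]
  exact ENNReal.ofReal_lt_top

theorem integral_norm_sq_radialLimit {a : ℕ → ℍ[ℝ]} (ha : MemHardy a) :
    ∫ u, ‖radialLimit (eval a) u‖ ^ 2 ∂polarVol = Real.pi ^ 2 * hardyNorm a ^ 2 := by
  have h0 : 0 ≤ ∑' n, ‖a n‖ ^ 2 := tsum_nonneg fun n => by positivity
  rw [integral_eq_lintegral_of_nonneg_ae (ae_of_all _ fun q => by positivity)
    (integrable_norm_sq_radialLimit ha).aestronglyMeasurable, lintegral_norm_sq_radialLimit ha,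
    ENNReal.toReal_ofReal (by positivity), hardyNorm_sq]

end QuatHardy

theorem mainTheorem10 (a : ℕ → ℍ[ℝ]) (ha : QuatHardy.MemHardy a) :
    -- the power series converges in the unit ball
    (∀ q : ℍ[ℝ], ‖q‖ < 1 → Summable fun n => q ^ n * a n) ∧
    -- the induced volumes are positive and finite, and the integrals converge
    (∀ r ∈ Ioo (0 : ℝ) 1,
      0 < QuatHardy.sphereVol r (sphere 0 r) ∧ QuatHardy.sphereVol r (sphere 0 r) < ∞ ∧
      IntegrableOn (fun q => ‖QuatHardy.eval a q‖ ^ 2) (sphere 0 r) (QuatHardy.sphereVol r)) ∧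
    -- the Hardy norm is the limit of the averages over the spheres
    Tendsto (fun r : ℝ => 1 / (QuatHardy.sphereVol r).real (sphere 0 r) *
        ∫ q in sphere 0 r, ‖QuatHardy.eval a q‖ ^ 2 ∂(QuatHardy.sphereVol r))
      (𝓝[<] 1) (𝓝 (QuatHardy.hardyNorm a ^ 2)) ∧
    -- the normalized volumes converge to the boundary volume, which is `(1/4) dt dA`, of mass `π²`
    (∀ u ∈ sphere (0 : ℍ[ℝ]) 1, Tendsto (fun r : ℝ => QuatHardy.scaledDensity r u)
      (𝓝[<] 1) (𝓝 (QuatHardy.boundaryDensity u))) ∧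
    QuatHardy.boundaryVol = QuatHardy.polarVol ∧
    QuatHardy.boundaryVol (sphere 0 1) = ENNReal.ofReal (Real.pi ^ 2) ∧
    -- the Hardy norm as limit of the integrals normalized by `1 - r²`
    Tendsto (fun r : ℝ => (1 - r ^ 2) / QuatHardy.boundaryVol.real (sphere 0 1) *
        ∫ q in sphere 0 r, ‖QuatHardy.eval a q‖ ^ 2 ∂(QuatHardy.sphereVol r))
      (𝓝[<] 1) (𝓝 (QuatHardy.hardyNorm a ^ 2)) ∧
    -- radial limits exist almost everywhere, and their square integral is a multiple of the norm
    (∀ᵐ u ∂QuatHardy.boundaryVol, Tendsto (fun r : ℝ => QuatHardy.eval a (r • u))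
      (𝓝[<] 1) (𝓝 (QuatHardy.radialLimit (QuatHardy.eval a) u))) ∧
    IntegrableOn (fun u => ‖QuatHardy.radialLimit (QuatHardy.eval a) u‖ ^ 2) (sphere 0 1)
      QuatHardy.boundaryVol ∧
    ∫ u in sphere 0 1, ‖QuatHardy.radialLimit (QuatHardy.eval a) u‖ ^ 2 ∂QuatHardy.boundaryVol =
      Real.pi ^ 2 * QuatHardy.hardyNorm a ^ 2 := by
  have hvol : QuatHardy.boundaryVol.real (sphere 0 1) = Real.pi ^ 2 := by
    rw [QuatHardy.boundaryVol_eq_polarVol, measureReal_def, QuatHardy.polarVol_sphere,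
      ENNReal.toReal_ofReal (by positivity)]
  refine ⟨fun q hq => QuatHardy.summable_eval ha hq, fun r hr => ⟨QuatHardy.sphereVol_sphere_pos hr,
    QuatHardy.sphereVol_sphere_lt_top hr,
    (QuatHardy.integrable_norm_sq_eval_sphereVol ha hr).integrableOn⟩,
    QuatHardy.tendsto_average ha, fun u hu => ?_, QuatHardy.boundaryVol_eq_polarVol, ?_, ?_, ?_, ?_, ?_⟩
  · rw [mem_sphere_zero_iff_norm] at hu
    rw [QuatHardy.boundaryDensity_eq hu]
    exact QuatHardy.tendsto_scaledDensity hu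
  · rw [QuatHardy.boundaryVol_eq_polarVol, QuatHardy.polarVol_sphere]
  · rw [hvol]
    exact QuatHardy.tendsto_scaled_integral ha
  · rw [QuatHardy.boundaryVol_eq_polarVol]
    exact QuatHardy.ae_tendsto_radialLimit ha
  · rw [QuatHardy.boundaryVol_eq_polarVol]
    exact (QuatHardy.integrable_norm_sq_radialLimit ha).integrableOn
  · rw [QuatHardy.boundaryVol_eq_polarVol, QuatHardy.polarVol_restrict]
    exact QuatHardy.integral_norm_sq_radialLimit ha
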